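/- Consider the two-way amplify-and-forward relay protocol with an energy harvesting relay. Let $P_1,P_2>0$ be the transmit powers of the sources $S_1,S_2$, let $0<\lambda<1$ be the power splitting ratio and $0<\eta\le 1$ the energy conversion efficiency, let $\sigma_a^2,\sigma_b^2\ge 0$ be the noise variances with $\sigma^2=\sigma_a^2+\sigma_b^2>0$, and let the channel gains $h_1,h_2$ be independent with $h_i\sim\mathcal{CN}(0,\Omega_i)$, $\Omega_i>0$. For $\{i,j\}=\{1,2\}$, after cancelling its own signal, $S_i$ receives $$\sqrt{\eta\lambda P_j}\,h_ih_jx_j+\sqrt{\eta\lambda}\,h_in_a+\sqrt{\tfrac{\eta\lambda}{1-\lambda}}\,h_in_b+n_i,$$ where $x_j$ has unit power and $n_a,n_b,n_i$ are independent noises of variances $\sigma_a^2,\sigma_b^2,\sigma^2$. Its signal-to-noise ratio is therefore $$\gamma_i=\frac{P_j}{\sigma^2}\,\frac{|h_1|^2|h_2|^2}{b|h_i|^2+c},\qquad b=1+\frac{\sigma_b^2}{\sigma^2}\,\frac{\lambda}{1-\lambda},\qquad c=\frac1{\eta\lambda}.$$ Let $C_e=\mathbb E\big[\tfrac12\log_2(1+\gamma_1)\big]+\mathbb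 E\big[\tfrac12\log_2(1+\gamma_2)\big]$ be the ergodic sum capacity. Put $$s_i=\frac{\sigma^2b}{P_i\Omega_i},\qquad A_i=\frac{\sigma^2c}{P_i\Omega_1\Omega_2},\qquad \mathcal J_{i,l}=\int_0^\infty\frac{e^{-s_iz}z^{l+1}\ln z}{1+z}\,dz,$$ let $\mathbf C$ be Euler's constant, and let $\Psi(\alpha,\beta;z)=\frac1{\Gamma(\alpha)}\int_0^\infty e^{-zt}t^{\alpha-1}(1+t)^{\beta-\alpha-1}\,dt$ ($\alpha,z>0$) be Tricomi's confluent hypergeometric function. Then both expectations are finite, all the integrals $\mathcal J_{i,l}$ and the series below converge absolutely, and $$C_e=\frac1{2\ln2}\sum_{i=1}^2\Psi(1,1;s_i)+\frac1{2\ln2}\sum_{i=1}^2\Bigg\{\sum_{l=1}^\infty\frac{A_i^{l+1}}{l!}\bigg[\Big(\ln A_i+2\mathbf C-\sum_{k=1}^{l}\frac1k-\sum_{k=1}^{l+1}\frac1k\Big)\Psi(l+2,l+2;s_i)+\frac{\mathcal J_{i,l}}{(l+1)!}\bigg]$$ $$\qquad\qquad+A_i\big(\ln A_i+2\mathbf C-1\big)\Psi(2,2;s_i)+A_i\,\mathcal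 J_{i,0}\Bigg\}.$$ -/

import Mathlib

open MeasureTheory ProbabilityTheory
open scoped NNReal

noncomputable section

/-- The circularly symmetric complex Gaussian law `CN(0, v)`: the real and imaginary parts are
independent real Gaussians with mean `0` and variance `v / 2`. -/
def complexGaussian (v : ℝ≥0) : Measure ℂ :=
  ((gaussianReal 0 (v / 2)).prod (gaussianReal 0 (v / 2))).map
    Complex.measurableEquivRealProd.symm

/-- Tricomi's confluent hypergeometric function `Ψ(α, β; z)` for real `α > 0`, real `β` and
`z > 0`, given by `Γ(α) Ψ(α, β; z) = ∫₀^∞ e^{-zt} t^{α-1} (1+t)^{β-α-1} dt`. -/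
def tricomiPsi (α β z : ℝ) : ℝ :=
  (Real.Gamma α)⁻¹ *
    ∫ t in Set.Ioi (0 : ℝ), Real.exp (-(z * t)) * t ^ (α - 1) * (1 + t) ^ (β - α - 1)

/-- Parameters of the two-way amplify-and-forward relaying protocol with an energy harvesting
(power splitting) relay. The sources `S₁`, `S₂` are indexed by `Fin 2`. -/
structure TwoWayRelay where
  /-- transmit powers of the two sources -/
  P : Fin 2 → ℝ
  /-- variances of the channel gains -/
  chanVar : Fin 2 → ℝ≥0
  /-- energy conversion efficiency -/
  eta : ℝ
  /-- power splitting ratio -/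
  lam : ℝ
  /-- variance of the antenna noise -/
  varA : ℝ
  /-- variance of the conversion noise -/
  varB : ℝ
  P_pos : ∀ i, 0 < P i
  chanVar_pos : ∀ i, 0 < chanVar i
  eta_pos : 0 < eta
  eta_le_one : eta ≤ 1
  lam_pos : 0 < lam
  lam_lt_one : lam < 1
  varA_nonneg : 0 ≤ varA
  varB_nonneg : 0 ≤ varB
  noise_pos : 0 < varA + varB

namespace TwoWayRelay

variable (T : TwoWayRelay)

/-- Total noise power `σ² = σ_a² + σ_b²`; this is also the noise variance at either source. -/
def var : ℝ := T.varA + T.varB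

/-- `ε = σ_b² / (σ_a² + σ_b²)`. -/
def eps : ℝ := T.varB / (T.varA + T.varB)

/-- `b = 1 + ε λ / (1 - λ)`. -/
def b : ℝ := 1 + T.eps * T.lam / (1 - T.lam)

/-- `c = 1 / (η λ)`. -/
def c : ℝ := 1 / (T.eta * T.lam)

/-- The SNR `γ_i` at the source `S_i` for channel gains `h`. After cancellation of the self
interference, `S_i` receives, with `j` the other source,
`√(ηλP_j) h_i h_j x_j + √(ηλ) h_i n_a + √(ηλ/(1-λ)) h_i n_b + n_i`,
where `x_j` has unit power and `n_a`, `n_b`, `n_i` are independent noises of variances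
`σ_a²`, `σ_b²`, `σ²`. The SNR is the signal power divided by the noise power. -/
def snr (i : Fin 2) (h : Fin 2 → ℂ) : ℝ :=
  ‖(√(T.eta * T.lam * T.P (1 - i)) : ℂ) * h i * h (1 - i)‖ ^ 2 /
    (‖(√(T.eta * T.lam) : ℂ) * h i‖ ^ 2 * T.varA
      + ‖(√(T.eta * T.lam / (1 - T.lam)) : ℂ) * h i‖ ^ 2 * T.varB
      + T.var)

/-- The closed form `γ_i = (P_j / σ²) |h_i|² |h_j|² / (b |h_i|² + c)` of the SNR. -/
theorem snr_eq (i : Fin 2) (h : Fin 2 → ℂ) :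
    T.snr i h = T.P (1 - i) / T.var *
      (‖h i‖ ^ 2 * ‖h (1 - i)‖ ^ 2 / (T.b * ‖h i‖ ^ 2 + T.c)) := by
  have h1 := T.eta_pos
  have h2 := T.lam_pos
  have h3 : 0 < 1 - T.lam := sub_pos.2 T.lam_lt_one
  have h4 := T.noise_pos
  have h5 := (T.P_pos (1 - i)).le
  have h6 := T.varA_nonneg
  have h7 := T.varB_nonneg
  have e1 : √(T.eta * T.lam * T.P (1 - i)) ^ 2 = T.eta * T.lam * T.P (1 - i) :=
    Real.sq_sqrt (by positivity)
  have e2 : √(T.eta * T.lam) ^ 2 = T.eta * T.lam := Real.sq_sqrt (by positivity)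
  have e3 : √(T.eta * T.lam / (1 - T.lam)) ^ 2 = T.eta * T.lam / (1 - T.lam) :=
    Real.sq_sqrt (by positivity)
  have d1 : T.eta * T.lam * ‖h i‖ ^ 2 * T.varA
      + T.eta * T.lam / (1 - T.lam) * ‖h i‖ ^ 2 * T.varB + (T.varA + T.varB)
      = (T.varA + T.varB) * (T.eta * T.lam) * (T.b * ‖h i‖ ^ 2 + T.c) := by
    unfold b c eps
    field_simp
    ring
  have hb : 0 < T.b * ‖h i‖ ^ 2 + T.c := by
    have : 0 ≤ T.b := by unfold b eps; positivity
    have : 0 < T.c := by unfold c; positivity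
    positivity
  unfold snr var
  simp only [norm_mul, mul_pow, Complex.norm_real, Real.norm_eq_abs, sq_abs, e1, e2, e3]
  rw [d1]
  field_simp

/-- The data rate `R_i = (1/2) log₂ (1 + γ_i)` at `S_i`. -/
def rate (i : Fin 2) (h : Fin 2 → ℂ) : ℝ := 1 / 2 * Real.logb 2 (1 + T.snr i h)

/-- The ergodic sum capacity `C_e = E[R₁] + E[R₂]` for random channel gains `h`. -/
def ergodicCapacity {S : Type*} [MeasurableSpace S] (μ : Measure S) (h : Fin 2 → S → ℂ) : ℝ :=
  ∑ i : Fin 2, ∫ ω, T.rate i (fun k => h k ω) ∂μ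

/-- `σ² b / (P_i Ω_i)`. -/
def psiArg (i : Fin 2) : ℝ := T.var * T.b / (T.P i * T.chanVar i)

/-- `σ² c / (P_i Ω₁ Ω₂)`. -/
def ratio (i : Fin 2) : ℝ := T.var * T.c / (T.P i * T.chanVar 0 * T.chanVar 1)

/-- The integrand of the residual integral `J_{i,l}`. -/
def residualIntegrand (i : Fin 2) (l : ℕ) (z : ℝ) : ℝ :=
  Real.exp (-(T.psiArg i * z)) * z ^ (l + 1) * Real.log z / (1 + z)

/-- The residual integral
`J_{i,l} = ∫₀^∞ exp(-σ²bz/(P_iΩ_i)) z^{l+1} ln z / (1+z) dz`. -/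
def residualIntegral (i : Fin 2) (l : ℕ) : ℝ :=
  ∫ z in Set.Ioi (0 : ℝ), T.residualIntegrand i l z

/-- The `l`-th term of the series of the capacity formula. -/
def seriesTerm (i : Fin 2) (l : ℕ) : ℝ :=
  T.ratio i ^ (l + 1) / (l.factorial : ℝ) *
    ((Real.log (T.ratio i) + 2 * Real.eulerMascheroniConstant
        - ∑ k ∈ Finset.Icc 1 l, 1 / (k : ℝ) - ∑ k ∈ Finset.Icc 1 (l + 1), 1 / (k : ℝ))
      * tricomiPsi ((l : ℝ) + 2) ((l : ℝ) + 2) (T.psiArg i)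
      + 1 / ((l + 1).factorial : ℝ) * T.residualIntegral i l)

end TwoWayRelay

end

noncomputable section

open Filter Topology Set

/-! The layer-cake formula gives `E[ln(1+γ_i)] = ∫₀^∞ P(γ_i > z)/(1+z) dz`. The squared moduli of
the gains are independent exponentials. Conditioning on `|h_i|²` and rescaling it to mean one gives
`P(γ_i > z) = e^{-s_j z} M₀(A_j z)`, where `M_n` is `besselMoment n` and `j` is the other source
(`measure_lt_snr`).

The capacity formula is then the logarithmic expansion of `M₀(y) = 2√y K₁(2√y)` at `y = 0`,
integrated term by term against `e^{-sz}/(1+z)`. The constant term 1 yields `Ψ(1,1;s)`; splitting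
`ln(Az)` into `ln A + ln z` in the others yields a Tricomi function and a residual integral. The
interchange is justified in `summable_integral_norm_capacityTerm`.

The expansion (`besselMoment_zero_eq_powerSum`) comes from an ODE. Since `M_n' = -M_{n+1}` and `y M₂
= M₀`, the function `M₀` solves `y f'' = f`, and so does the candidate series. Their difference and
its derivative tend to 0 at the origin, so a Wronskian argument (`eq_zero_of_mul_deriv_deriv_eq`)
makes the difference vanish. The delicate input is `M₁(y) + ln y → -2γ` with `γ` Euler's constant,
obtained from `Γ'(1) = -γ` after an integration by parts. -/

/-! ### Bessel-type integrals and their differential equation. -/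

/-- The integral `∫₀^∞ u⁻ⁿ e^{-u-y/u} du`, which for `y > 0` is a multiple of the modified Bessel
function `K_{n-1}(2√y)`. -/
def besselMoment (n : ℕ) (y : ℝ) : ℝ :=
  ∫ u in Ioi (0 : ℝ), Real.exp (-u - y / u) / u ^ n

/-- From `xⁿ/n! ≤ eˣ` at `x = a/u`: the factor `e^{-y/u}` absorbs the singularity `u⁻ⁿ`. Uniformity
in `y ≥ a` is what differentiation under the integral needs. -/
lemma exp_sub_div_pow_le (n : ℕ) {a y u : ℝ} (ha : 0 < a) (hay : a ≤ y) (hu : 0 < u) :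
    Real.exp (-u - y / u) / u ^ n ≤ (n.factorial / a ^ n) * Real.exp (-u) := by
  have h1 : (a / u) ^ n / n.factorial ≤ Real.exp (a / u) :=
    Real.pow_div_factorial_le_exp _ (by positivity) n
  have h2 : Real.exp (-u - y / u) ≤ Real.exp (-u) * (Real.exp (a / u))⁻¹ := by
    rw [← Real.exp_neg, ← Real.exp_add]
    apply Real.exp_le_exp.2
    have : a / u ≤ y / u := by gcongr
    linarith
  have hf : (0 : ℝ) < n.factorial := by exact_mod_cast n.factorial_pos
  calc Real.exp (-u - y / u) / u ^ n
      ≤ Real.exp (-u) * ((a / u) ^ n / n.factorial)⁻¹ / u ^ n := by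
        gcongr
        refine h2.trans ?_
        gcongr
    _ = (n.factorial / a ^ n) * Real.exp (-u) := by
        rw [div_pow]
        field_simp

lemma integrableOn_exp_neg_Ioi_zero : IntegrableOn (fun u : ℝ => Real.exp (-u)) (Ioi 0) :=
  integrableOn_exp_neg_Ioi 0

lemma integrableOn_besselMoment (n : ℕ) {y : ℝ} (hy : 0 < y) :
    IntegrableOn (fun u => Real.exp (-u - y / u) / u ^ n) (Ioi (0 : ℝ)) := by
  refine Integrable.mono' (integrableOn_exp_neg_Ioi_zero.const_mul (n.factorial / y ^ n))
    (Measurable.aestronglyMeasurable (by fun_prop)) ?_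
  filter_upwards [ae_restrict_mem measurableSet_Ioi] with u hu
  have hu : 0 < u := hu
  rw [Real.norm_of_nonneg (by positivity)]
  exact exp_sub_div_pow_le n hy le_rfl hu

lemma hasDerivAt_besselMoment (n : ℕ) {y : ℝ} (hy : 0 < y) :
    HasDerivAt (besselMoment n) (-besselMoment (n + 1) y) y := by
  have := hasDerivAt_integral_of_dominated_loc_of_deriv_le (μ := volume.restrict (Ioi (0 : ℝ)))
    (F := fun (x u : ℝ) => Real.exp (-u - x / u) / u ^ n) (x₀ := y)
    (F' := fun (x u : ℝ) => -(Real.exp (-u - x / u) / u ^ (n + 1)))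
    (bound := fun u => ((n + 1).factorial / (y / 2) ^ (n + 1)) * Real.exp (-u))
    -- On the neighbourhood `x > y/2` the dominating function is independent of `x`.
    (Ioi_mem_nhds (half_lt_self hy))
    (Eventually.of_forall fun x => Measurable.aestronglyMeasurable (by fun_prop))
    (integrableOn_besselMoment n hy) (Measurable.aestronglyMeasurable (by fun_prop))
    ?_ (integrableOn_exp_neg_Ioi_zero.const_mul _) ?_
  · rw [integral_neg] at this
    exact this.2
  · filter_upwards [ae_restrict_mem measurableSet_Ioi] with u hu x hx
    have hu : 0 < u := hu
    rw [norm_neg, Real.norm_of_nonneg (by positivity)]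
    exact exp_sub_div_pow_le (n + 1) (half_pos hy) (le_of_lt hx) hu
  · filter_upwards [ae_restrict_mem measurableSet_Ioi] with u hu x hx
    have hu : 0 < u := hu
    have h1 : HasDerivAt (fun x : ℝ => -u - x / u) (-(1 / u)) x :=
      ((hasDerivAt_id x).div_const u).const_sub (-u)
    refine (h1.exp.div_const (u ^ n)).congr_deriv ?_
    rw [pow_succ]
    field_simp

/-- The substitution `t = y/u`, split into an inversion (the power substitution with exponent `-1`)
and a scaling by `y`. -/
lemma integral_div_sq_mul_comp_div (g : ℝ → ℝ) {y : ℝ} (hy : 0 < y) :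
    ∫ u in Ioi (0 : ℝ), y / u ^ 2 * g (y / u) = ∫ t in Ioi (0 : ℝ), g t := by
  have h1 := integral_comp_rpow_Ioi (fun t => g (y * t)) (p := -1) (by norm_num)
  rw [integral_comp_mul_left_Ioi g 0 hy, mul_zero] at h1
  have h2 : ∫ u in Ioi (0 : ℝ), y / u ^ 2 * g (y / u)
      = y * ∫ u in Ioi (0 : ℝ), (|(-1 : ℝ)| * u ^ ((-1 : ℝ) - 1)) • g (y * u ^ (-1 : ℝ)) := by
    rw [← integral_const_mul]
    refine setIntegral_congr_fun measurableSet_Ioi fun u hu => ?_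
    have hu : 0 < u := hu
    have e1 : u ^ ((-1 : ℝ) - 1) = (u ^ 2)⁻¹ := by
      rw [show (-1 : ℝ) - 1 = -(2 : ℕ) by norm_num, Real.rpow_neg hu.le, Real.rpow_natCast]
    simp only [e1, Real.rpow_neg_one, abs_neg, abs_one, smul_eq_mul, div_eq_mul_inv]
    ring
  rw [h2, h1, smul_eq_mul, mul_inv_cancel_left₀ hy.ne']

/-- The exponent `-u - y/u` is invariant under `u ↦ y/u`, and the Jacobian `y/u²` supplies the
weight. Together with `hasDerivAt_besselMoment` this is the equation `y M₀'' = M₀`. -/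
lemma mul_besselMoment_two {y : ℝ} (hy : 0 < y) : y * besselMoment 2 y = besselMoment 0 y := by
  unfold besselMoment
  rw [← integral_div_sq_mul_comp_div (fun u => Real.exp (-u - y / u) / u ^ 0) hy,
    ← integral_const_mul]
  refine setIntegral_congr_fun measurableSet_Ioi fun u hu => ?_
  have hu : 0 < u := hu
  have : -(y / u) - y / (y / u) = -u - y / u := by field_simp; ring
  simp only [this]
  field_simp

/-! ### Behaviour of the integrals as `y → 0⁺`. -/

/-- Apply `ln x ≤ x - 1` to `u` and to `u^{-1/2}`. Against `e^{-u}` the two bounds are Gamma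
integrals at 2 and 1/2. -/
lemma abs_log_le {u : ℝ} (hu : 0 < u) : |Real.log u| ≤ 2 * u ^ (-(1 / 2) : ℝ) + u := by
  have h1 := Real.log_le_sub_one_of_pos hu
  have h3 : 0 < u ^ (-(1 / 2) : ℝ) := by positivity
  have h2 := Real.log_le_sub_one_of_pos h3
  rw [Real.log_rpow hu] at h2
  rw [abs_le]
  constructor <;> linarith

lemma integrableOn_log_mul_exp_neg :
    IntegrableOn (fun u : ℝ => |Real.log u| * Real.exp (-u)) (Ioi 0) := by
  have h1 := (Real.GammaIntegral_convergent (s := 1 / 2) (by norm_num)).const_mul 2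
  have h2 := Real.GammaIntegral_convergent (s := 2) (by norm_num)
  refine Integrable.mono' (h1.add h2) (Measurable.aestronglyMeasurable (by fun_prop)) ?_
  filter_upwards [ae_restrict_mem measurableSet_Ioi] with u hu
  have hu : 0 < u := hu
  rw [Real.norm_of_nonneg (by positivity)]
  have := mul_le_mul_of_nonneg_right (abs_log_le hu) (Real.exp_pos (-u)).le
  refine this.trans (le_of_eq ?_)
  simp only [Pi.add_apply]
  norm_num
  ring

/-- The left side is `Γ'(1)`, by differentiating the complex Gamma integral at 1. -/
lemma integral_log_mul_exp_neg :
    ∫ u in Ioi (0 : ℝ), Real.log u * Real.exp (-u) = -Real.eulerMascheroniConstant := by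
  have h1 := Complex.hasDerivAt_GammaIntegral (s := 1) (by simp)
  have h2 := Complex.hasDerivAt_Gamma_one
  have h3 : Complex.Gamma =ᶠ[𝓝 1] Complex.GammaIntegral := by
    have : {s : ℂ | 0 < s.re} ∈ 𝓝 (1 : ℂ) :=
      (isOpen_lt continuous_const Complex.continuous_re).mem_nhds (by simp)
    filter_upwards [this] with s hs using Complex.Gamma_eq_integral hs
  have h4 := (h1.congr_of_eventuallyEq h3).unique h2
  simp only [sub_self, Complex.cpow_zero, one_mul, ← Complex.ofReal_mul] at h4
  rw [integral_complex_ofReal] at h4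
  exact_mod_cast h4

/-- The integral `∫₀^∞ ln u e^{-u-y/u} du`. -/
def logBesselMoment (y : ℝ) : ℝ :=
  ∫ u in Ioi (0 : ℝ), Real.log u * Real.exp (-u - y / u)

lemma exp_sub_div_le_exp_neg {y u : ℝ} (hy : 0 ≤ y) (hu : 0 < u) :
    Real.exp (-u - y / u) ≤ Real.exp (-u) := by
  apply Real.exp_le_exp.2
  have : 0 ≤ y / u := by positivity
  linarith

lemma integrableOn_logBesselMoment {y : ℝ} (hy : 0 ≤ y) :
    IntegrableOn (fun u => Real.log u * Real.exp (-u - y / u)) (Ioi (0 : ℝ)) := by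
  refine Integrable.mono' integrableOn_log_mul_exp_neg
    (Measurable.aestronglyMeasurable (by fun_prop)) ?_
  filter_upwards [ae_restrict_mem measurableSet_Ioi] with u hu
  rw [norm_mul, Real.norm_eq_abs, Real.norm_of_nonneg (Real.exp_pos _).le]
  exact mul_le_mul_of_nonneg_left (exp_sub_div_le_exp_neg hy hu) (abs_nonneg _)

lemma tendsto_logBesselMoment :
    Tendsto logBesselMoment (𝓝[>] 0) (𝓝 (-Real.eulerMascheroniConstant)) := by
  rw [← integral_log_mul_exp_neg]
  refine tendsto_integral_filter_of_dominated_convergence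
    (fun u : ℝ => |Real.log u| * Real.exp (-u))
    (Eventually.of_forall fun y => Measurable.aestronglyMeasurable (by fun_prop)) ?_
    integrableOn_log_mul_exp_neg ?_
  · filter_upwards [self_mem_nhdsWithin] with y hy
    filter_upwards [ae_restrict_mem measurableSet_Ioi] with u hu
    rw [norm_mul, Real.norm_eq_abs, Real.norm_of_nonneg (Real.exp_pos _).le]
    exact mul_le_mul_of_nonneg_left (exp_sub_div_le_exp_neg (le_of_lt hy) hu) (abs_nonneg _)
  · refine Eventually.of_forall fun u => ?_
    have : Continuous fun y : ℝ => Real.log u * Real.exp (-u - y / u) := by fun_prop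
    simpa using (this.tendsto 0).mono_left nhdsWithin_le_nhds

/-- Integrate `u⁻¹ e^{-u-y/u}` by parts with primitive `ln u`. The resulting term with weight `y/u²`
is transformed by `u ↦ y/u`, which turns `ln u` into `ln y - ln u`. This isolates the logarithmic
singularity of `M₁`. -/
lemma besselMoment_one_eq {y : ℝ} (hy : 0 < y) :
    besselMoment 1 y = 2 * logBesselMoment y - Real.log y * besselMoment 0 y := by
  set v : ℝ → ℝ := fun u => Real.exp (-u - y / u) with hv
  have hvb : ∀ u, 0 < u → v u / u ^ 2 ≤ 2 / y ^ 2 * Real.exp (-u) := fun u hu => by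
    simpa using exp_sub_div_pow_le 2 hy le_rfl hu
  have i1 : IntegrableOn (fun u => Real.log u * v u) (Ioi 0) := integrableOn_logBesselMoment hy.le
  have i2 : IntegrableOn (fun u => y / u ^ 2 * (Real.log u * v u)) (Ioi 0) := by
    refine Integrable.mono' (integrableOn_log_mul_exp_neg.const_mul (2 / y))
      (Measurable.aestronglyMeasurable (by fun_prop)) ?_
    filter_upwards [ae_restrict_mem measurableSet_Ioi] with u hu
    have hu : 0 < u := hu
    have hvp : 0 < v u := Real.exp_pos _
    rw [norm_mul, norm_mul, Real.norm_of_nonneg (by positivity), Real.norm_eq_abs,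
      Real.norm_of_nonneg hvp.le]
    calc y / u ^ 2 * (|Real.log u| * v u) = y * |Real.log u| * (v u / u ^ 2) := by ring
      _ ≤ y * |Real.log u| * (2 / y ^ 2 * Real.exp (-u)) := by
        gcongr
        exact hvb u hu
      _ = _ := by field_simp
  have i3 : IntegrableOn (fun u => v u / u) (Ioi 0) := by
    simpa using integrableOn_besselMoment 1 hy
  have key := integral_Ioi_mul_deriv_eq_deriv_mul (a := (0 : ℝ)) (a' := (0 : ℝ)) (b' := (0 : ℝ))
    (u := Real.log) (v := v)
    (u' := fun u => u⁻¹) (v' := fun u => y / u ^ 2 * v u - v u)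
    (fun x hx => Real.hasDerivAt_log (ne_of_gt hx)) (fun x hx => ?_) ?_ ?_ ?_ ?_
  · have e1 : ∫ u in Ioi (0 : ℝ), Real.log u * (y / u ^ 2 * v u - v u)
        = (∫ u in Ioi (0 : ℝ), y / u ^ 2 * (Real.log u * v u)) - logBesselMoment y := by
      unfold logBesselMoment
      rw [← integral_sub i2 i1]
      congr 1
      ext u
      ring
    have e2 : ∫ u in Ioi (0 : ℝ), y / u ^ 2 * (Real.log u * v u)
        = Real.log y * besselMoment 0 y - logBesselMoment y := by
      rw [besselMoment, logBesselMoment, ← integral_const_mul, ← integral_sub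
        ((integrableOn_besselMoment 0 hy).const_mul _) i1, ← integral_div_sq_mul_comp_div
        (fun u => Real.log y * (Real.exp (-u - y / u) / u ^ 0)
          - Real.log u * Real.exp (-u - y / u)) hy]
      refine setIntegral_congr_fun measurableSet_Ioi fun u hu => ?_
      have hu : 0 < u := hu
      have e : -(y / u) - y / (y / u) = -u - y / u := by field_simp; ring
      simp only [e, hv, Real.log_div hy.ne' hu.ne', pow_zero, div_one]
      ring
    have e3 : ∫ u in Ioi (0 : ℝ), u⁻¹ * v u = besselMoment 1 y := by
      unfold besselMoment
      congr 1
      ext u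
      simp only [hv, pow_one]
      ring
    rw [e1, e2, e3] at key
    linarith
  · have hx : 0 < x := hx
    have h1 : HasDerivAt (fun u : ℝ => -u - y / u) (-1 - (0 * x - y * 1) / x ^ 2) x :=
      (hasDerivAt_id x).neg.sub ((hasDerivAt_const x y).div (hasDerivAt_id x) hx.ne')
    refine h1.exp.congr_deriv ?_
    simp only [hv]
    ring
  · refine (i2.sub i1).congr (Eventually.of_forall fun u => ?_)
    change y / u ^ 2 * (Real.log u * v u) - Real.log u * v u
      = Real.log u * (y / u ^ 2 * v u - v u)
    ring
  · refine i3.congr (Eventually.of_forall fun u => ?_)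
    change v u / u = u⁻¹ * v u
    ring
  -- Boundary term at 0: `e^{-u-y/u} ≤ u/y` beats the logarithm.
  · have h0 : Tendsto (fun u : ℝ => 1 / y * |Real.log u * u ^ (1 : ℝ)|) (𝓝[>] 0) (𝓝 0) := by
      simpa using ((tendsto_log_mul_rpow_nhdsGT_zero one_pos).abs.const_mul (1 / y))
    refine squeeze_zero_norm' ?_ h0
    filter_upwards [self_mem_nhdsWithin] with u hu
    have hu : 0 < u := hu
    have := exp_sub_div_pow_le 1 hy le_rfl hu
    have h1 : v u ≤ 1 / y * u := by
      have h2 : Real.exp (-u) ≤ 1 := Real.exp_le_one_iff.2 (by linarith)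
      have h3 : v u / u ≤ 1 / y := by
        refine (by simpa using this : v u / u ≤ 1 / y * Real.exp (-u)).trans ?_
        exact mul_le_of_le_one_right (by positivity) h2
      rwa [div_le_iff₀ hu] at h3
    have hvp : 0 < v u := Real.exp_pos _
    simp only [Pi.mul_apply, norm_mul, Real.norm_eq_abs, abs_mul, Real.rpow_one, abs_of_pos hu,
      abs_of_pos hvp]
    calc |Real.log u| * v u ≤ |Real.log u| * (1 / y * u) := by gcongr
      _ = _ := by ring
  · have h0 : Tendsto (fun u : ℝ => u ^ 1 * Real.exp (-u)) atTop (𝓝 0) :=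
      Real.tendsto_pow_mul_exp_neg_atTop_nhds_zero 1
    refine squeeze_zero_norm' ?_ h0
    filter_upwards [eventually_ge_atTop 1] with u hu
    have hu0 : 0 < u := by linarith
    have hvp : 0 < v u := Real.exp_pos _
    simp only [Pi.mul_apply, norm_mul, Real.norm_eq_abs, abs_of_pos hvp,
      abs_of_nonneg (Real.log_nonneg hu), pow_one]
    exact mul_le_mul ((Real.log_le_sub_one_of_pos hu0).trans (by linarith))
      (exp_sub_div_le_exp_neg hy.le hu0) hvp.le hu0.le

/-- Uses `1 - e^{-x} ≤ √x` at `x = y/u`. The exponent 1/2 keeps `u^{-1/2} e^{-u}` integrable at 0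
while leaving a power of `y` strong enough to kill `ln y`. -/
lemma abs_besselMoment_zero_sub_one_le {y : ℝ} (hy : 0 < y) :
    |besselMoment 0 y - 1| ≤ Real.Gamma (1 / 2) * y ^ (1 / 2 : ℝ) := by
  have e1 : besselMoment 0 y - 1
      = ∫ u in Ioi (0 : ℝ), (Real.exp (-u - y / u) - Real.exp (-u)) := by
    have := integral_exp_neg_Ioi_zero
    have h0 : IntegrableOn (fun u => Real.exp (-u - y / u)) (Ioi 0) := by
      simpa using integrableOn_besselMoment 0 hy
    rw [integral_sub h0 integrableOn_exp_neg_Ioi_zero, this]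
    simp [besselMoment]
  have h1 := (Real.GammaIntegral_convergent (s := 1 / 2) (by norm_num)).mul_const (y ^ (1 / 2 : ℝ))
  rw [e1, Real.Gamma_eq_integral (by norm_num), ← integral_mul_const, ← Real.norm_eq_abs]
  refine norm_integral_le_of_norm_le h1 ?_
  filter_upwards [ae_restrict_mem measurableSet_Ioi] with u hu
  have hu : 0 < u := hu
  have e2 : Real.exp (-u - y / u) - Real.exp (-u)
      = -(Real.exp (-u) * (1 - Real.exp (-(y / u)))) := by
    rw [sub_eq_add_neg (-u), Real.exp_add]
    ring
  have hyu : 0 < y / u := by positivity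
  have h2 : Real.exp (-(y / u)) ≤ 1 := Real.exp_le_one_iff.2 (by linarith)
  have h3 : 1 - Real.exp (-(y / u)) ≤ (y / u) ^ (1 / 2 : ℝ) := by
    rcases le_total (y / u) 1 with h | h
    · have := Real.add_one_le_exp (-(y / u))
      have h4 : (y / u) ^ (1 : ℝ) ≤ (y / u) ^ (1 / 2 : ℝ) :=
        Real.rpow_le_rpow_of_exponent_ge hyu h (by norm_num)
      rw [Real.rpow_one] at h4
      linarith
    · have h4 : 1 ≤ (y / u) ^ (1 / 2 : ℝ) := Real.one_le_rpow h (by norm_num)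
      have := Real.exp_pos (-(y / u))
      linarith
  rw [e2, norm_neg, norm_mul, Real.norm_of_nonneg (Real.exp_pos _).le,
    Real.norm_of_nonneg (by linarith)]
  calc Real.exp (-u) * (1 - Real.exp (-(y / u)))
      ≤ Real.exp (-u) * (y / u) ^ (1 / 2 : ℝ) := by gcongr
    _ = _ := by
      rw [Real.div_rpow hy.le hu.le, show (1 / 2 - 1 : ℝ) = -(1 / 2) by norm_num,
        Real.rpow_neg hu.le]
      field_simp

lemma tendsto_besselMoment_zero : Tendsto (besselMoment 0) (𝓝[>] 0) (𝓝 1) := by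
  have h0 : Tendsto (fun y : ℝ => Real.Gamma (1 / 2) * y ^ (1 / 2 : ℝ)) (𝓝[>] 0) (𝓝 0) := by
    have : ContinuousAt (fun y : ℝ => Real.Gamma (1 / 2) * y ^ (1 / 2 : ℝ)) 0 :=
      (Real.continuousAt_rpow_const 0 (1 / 2) (Or.inr (by norm_num))).const_mul _
    have := this.tendsto
    simp only [Real.zero_rpow (by norm_num : (1 / 2 : ℝ) ≠ 0), mul_zero] at this
    exact this.mono_left nhdsWithin_le_nhds
  rw [tendsto_iff_norm_sub_tendsto_zero]
  refine squeeze_zero' (Eventually.of_forall fun _ => norm_nonneg _) ?_ h0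
  filter_upwards [self_mem_nhdsWithin] with y hy using abs_besselMoment_zero_sub_one_le hy

lemma tendsto_log_mul_besselMoment_zero_sub_one :
    Tendsto (fun y => Real.log y * (besselMoment 0 y - 1)) (𝓝[>] 0) (𝓝 0) := by
  have h0 := ((tendsto_log_mul_rpow_nhdsGT_zero (r := 1 / 2) (by norm_num)).abs).const_mul
    (Real.Gamma (1 / 2))
  rw [abs_zero, mul_zero] at h0
  refine squeeze_zero_norm' ?_ h0
  filter_upwards [self_mem_nhdsWithin] with y hy
  have hy : 0 < y := hy
  rw [norm_mul, Real.norm_eq_abs, Real.norm_eq_abs, abs_mul,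
    abs_of_nonneg (by positivity : 0 ≤ y ^ (1 / 2 : ℝ))]
  calc |Real.log y| * |besselMoment 0 y - 1|
      ≤ |Real.log y| * (Real.Gamma (1 / 2) * y ^ (1 / 2 : ℝ)) := by
        gcongr
        exact abs_besselMoment_zero_sub_one_le hy
    _ = _ := by ring

lemma tendsto_besselMoment_one_add_log :
    Tendsto (fun y => besselMoment 1 y + Real.log y) (𝓝[>] 0)
      (𝓝 (-(2 * Real.eulerMascheroniConstant))) := by
  have := (tendsto_logBesselMoment.const_mul 2).sub tendsto_log_mul_besselMoment_zero_sub_one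
  rw [show 2 * -Real.eulerMascheroniConstant - 0 = -(2 * Real.eulerMascheroniConstant) by ring]
    at this
  refine this.congr' ?_
  filter_upwards [self_mem_nhdsWithin] with y hy
  rw [besselMoment_one_eq hy]
  ring

/-! ### Power series with coefficients of size `O(1/n!)`. -/

/-- The sum `∑ aₙ yⁿ`. -/
def powerSum (a : ℕ → ℝ) (y : ℝ) : ℝ := ∑' n, a n * y ^ n

/-- Coefficients dominated by those of a multiple of the exponential series. -/
def ExpBounded (a : ℕ → ℝ) : Prop := ∃ K : ℝ, ∀ n, |a n| ≤ K / n.factorial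

/-- The coefficients of the derivative of `∑ aₙ yⁿ`. -/
def derivCoeff (a : ℕ → ℝ) (n : ℕ) : ℝ := (n + 1) * a (n + 1)

lemma ExpBounded.summable {a : ℕ → ℝ} (ha : ExpBounded a) (y : ℝ) :
    Summable fun n => a n * y ^ n := by
  obtain ⟨K, hK⟩ := ha
  refine Summable.of_norm_bounded ((Real.summable_pow_div_factorial |y|).mul_left K) fun n => ?_
  rw [norm_mul, norm_pow, Real.norm_eq_abs, Real.norm_eq_abs]
  calc |a n| * |y| ^ n ≤ K / n.factorial * |y| ^ n := by
        gcongr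
        exact hK n
    _ = _ := by ring

lemma ExpBounded.derivCoeff {a : ℕ → ℝ} (ha : ExpBounded a) : ExpBounded (derivCoeff a) := by
  obtain ⟨K, hK⟩ := ha
  refine ⟨K, fun n => ?_⟩
  have := hK (n + 1)
  rw [_root_.derivCoeff, abs_mul, abs_of_nonneg (by positivity : (0 : ℝ) ≤ n + 1)]
  calc ((n : ℝ) + 1) * |a (n + 1)| ≤ (n + 1) * (K / (n + 1).factorial) := by gcongr
    _ = K / n.factorial := by
      rw [Nat.factorial_succ]
      push_cast
      field_simp

lemma ExpBounded.shift {a : ℕ → ℝ} (ha : ExpBounded a) : ExpBounded fun n => a (n + 1) := by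
  obtain ⟨K, hK⟩ := ha.derivCoeff
  refine ⟨K, fun n => le_trans ?_ (hK n)⟩
  rw [_root_.derivCoeff, abs_mul, abs_of_nonneg (by positivity : (0 : ℝ) ≤ n + 1)]
  exact le_mul_of_one_le_left (abs_nonneg _) (by linarith [(n.cast_nonneg : (0 : ℝ) ≤ n)])

lemma mul_powerSum_shift {a : ℕ → ℝ} (ha : ExpBounded a) (y : ℝ) :
    y * powerSum (fun n => a (n + 1)) y = powerSum a y - a 0 := by
  unfold powerSum
  rw [(ha.summable y).tsum_eq_zero_add, ← tsum_mul_left]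
  simp only [pow_zero, mul_one, add_sub_cancel_left]
  congr 1
  ext n
  ring

lemma powerSum_zero (a : ℕ → ℝ) : powerSum a 0 = a 0 := by
  rw [powerSum, tsum_eq_single 0 (fun n hn => by simp [hn])]
  simp

/-- Termwise differentiation on the ball of radius `|y| + 1`, where the differentiated terms are
dominated by an exponential series. -/
lemma hasDerivAt_powerSum {a : ℕ → ℝ} (ha : ExpBounded a) (y : ℝ) :
    HasDerivAt (powerSum a) (powerSum (derivCoeff a) y) y := by
  obtain ⟨K, hK⟩ := ha.derivCoeff
  set R := |y| + 1 with hR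
  have hR0 : 0 ≤ R := by positivity
  have hsum : Summable fun n : ℕ => |a n| * n * R ^ (n - 1) := by
    rw [← summable_nat_add_iff 1]
    refine Summable.of_nonneg_of_le (fun n => by positivity) (fun n => ?_)
      ((Real.summable_pow_div_factorial R).mul_left K)
    have := hK n
    rw [derivCoeff, abs_mul, abs_of_nonneg (by positivity : (0 : ℝ) ≤ n + 1)] at this
    calc |a (n + 1)| * ((n + 1 : ℕ) : ℝ) * R ^ (n + 1 - 1)
        = ((n : ℝ) + 1) * |a (n + 1)| * R ^ n := by
          push_cast
          ring
      _ ≤ K / n.factorial * R ^ n := by gcongr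
      _ = _ := by ring
  have hy : y ∈ Metric.ball (0 : ℝ) R := by simp [hR]
  have hb : ∀ (n : ℕ), ∀ z ∈ Metric.ball (0 : ℝ) R,
      ‖a n * (n * z ^ (n - 1))‖ ≤ |a n| * n * R ^ (n - 1) := fun n z hz => by
    have hz' : |z| ≤ R := by
      have := Metric.mem_ball.1 hz
      rw [Real.dist_eq, sub_zero] at this
      exact this.le
    rw [norm_mul, norm_mul, norm_pow, Real.norm_eq_abs, Real.norm_eq_abs, Real.norm_eq_abs,
      Nat.abs_cast, mul_assoc]
    gcongr
  have h := hasDerivAt_tsum_of_isPreconnected (g := fun n z => a n * z ^ n)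
    (g' := fun n z => a n * (n * z ^ (n - 1))) hsum Metric.isOpen_ball
    (convex_ball (0 : ℝ) R).isPreconnected
    (fun n z _ => (hasDerivAt_pow n z).const_mul (a n)) hb hy (ha.summable y) hy
  have e : ∑' n, a n * (n * y ^ (n - 1)) = powerSum (derivCoeff a) y := by
    rw [powerSum, (Summable.of_norm_bounded hsum fun n => hb n y hy).tsum_eq_zero_add]
    simp only [Nat.cast_zero, zero_mul, mul_zero, zero_add]
    congr 1
    ext n
    simp only [derivCoeff]
    push_cast
    ring
  exact e ▸ h

lemma continuous_powerSum {a : ℕ → ℝ} (ha : ExpBounded a) : Continuous (powerSum a) :=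
  continuous_iff_continuousAt.2 fun y => (hasDerivAt_powerSum ha y).continuousAt

lemma tendsto_powerSum {a : ℕ → ℝ} (ha : ExpBounded a) :
    Tendsto (powerSum a) (𝓝[>] 0) (𝓝 (a 0)) := by
  have := ((continuous_powerSum ha).tendsto 0).mono_left (nhdsWithin_le_nhds (s := Ioi 0))
  rwa [powerSum_zero] at this

lemma tendsto_log_mul_self_nhdsGT_zero :
    Tendsto (fun y : ℝ => Real.log y * y) (𝓝[>] 0) (𝓝 0) := by
  simpa using tendsto_log_mul_rpow_nhdsGT_zero one_pos

/-- Removing the constant term leaves a factor `y`, and `y ln y → 0`. -/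
lemma tendsto_log_mul_powerSum_sub {a : ℕ → ℝ} (ha : ExpBounded a) :
    Tendsto (fun y => Real.log y * (powerSum a y - a 0)) (𝓝[>] 0) (𝓝 0) := by
  have h := tendsto_log_mul_self_nhdsGT_zero.mul (tendsto_powerSum ha.shift)
  rw [zero_mul] at h
  refine h.congr fun y => ?_
  rw [← mul_powerSum_shift ha]
  ring

/-! ### Uniqueness for the equation and the logarithmic expansion. -/

/-- A solution of `y D'' = D` on `(0, ∞)` with `D → 0` and `D' → 0` at `0` vanishes. -/
lemma eq_zero_of_mul_deriv_deriv_eq {D E I J : ℝ → ℝ}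
    (hD : ∀ y, 0 < y → HasDerivAt D (E y) y) (hE : ∀ y, 0 < y → HasDerivAt E (D y / y) y)
    (hI : ∀ y, 0 < y → HasDerivAt I (J y) y) (hJ : ∀ y, 0 < y → HasDerivAt J (I y / y) y)
    (hIpos : ∀ y, 0 < y → 0 < I y) (hD0 : Tendsto D (𝓝[>] 0) (𝓝 0))
    (hE0 : Tendsto E (𝓝[>] 0) (𝓝 0)) (hI0 : Tendsto I (𝓝[>] 0) (𝓝 0))
    (hJ0 : Tendsto J (𝓝[>] 0) (𝓝 1)) {y : ℝ} (hy : 0 < y) : D y = 0 := by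
  have const : ∀ f : ℝ → ℝ, (∀ x, 0 < x → HasDerivAt f 0 x) → ∀ x, 0 < x → f x = f 1 := by
    intro f hf x hx
    refine isOpen_Ioi.is_const_of_deriv_eq_zero (isPreconnected_Ioi (a := (0 : ℝ)))
      (fun z hz => (hf z hz).differentiableAt.differentiableWithinAt)
      (fun z hz => (hf z hz).deriv) hx (mem_Ioi.2 one_pos)
  -- The Wronskian of `D` and `I` is constant, as the equation has no first-order term; the limits
  -- at 0 make it zero.
  have hW : ∀ x, 0 < x → D x * J x - E x * I x = D 1 * J 1 - E 1 * I 1 :=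
    const (fun x => D x * J x - E x * I x) fun x hx =>
      (((hD x hx).mul (hJ x hx)).sub ((hE x hx).mul (hI x hx))).congr_deriv (by ring)
  have hW1 : D 1 * J 1 - E 1 * I 1 = 0 := by
    have h1 : Tendsto (fun x => D x * J x - E x * I x) (𝓝[>] 0) (𝓝 0) := by
      simpa using (hD0.mul hJ0).sub (hE0.mul hI0)
    refine tendsto_nhds_unique (tendsto_const_nhds.congr' ?_) h1
    filter_upwards [self_mem_nhdsWithin] with x hx using (hW x hx).symm
  -- The numerator of `(D/I)'` is minus the Wronskian, so `D` is a constant multiple of `I`.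
  have hk : ∀ x, 0 < x → D x / I x = D 1 / I 1 := by
    refine const (fun x => D x / I x) fun x hx =>
      ((hD x hx).div (hI x hx) (hIpos x hx).ne').congr_deriv ?_
    have := hW x hx
    rw [hW1] at this
    rw [div_eq_zero_iff]
    left
    linarith
  have hDk : ∀ x, 0 < x → D x = D 1 / I 1 * I x := fun x hx => by
    rw [← hk x hx, div_mul_cancel₀ _ (hIpos x hx).ne']
  have hEk : ∀ x, 0 < x → E x = D 1 / I 1 * J x := fun x hx => by
    refine (hD x hx).unique (((hI x hx).const_mul (D 1 / I 1)).congr_of_eventuallyEq ?_)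
    filter_upwards [Ioi_mem_nhds hx] with z hz using hDk z hz
  -- The multiple is the limit of `E` at 0, because `J → 1`.
  have hk0 : D 1 / I 1 = 0 := by
    have h1 : Tendsto E (𝓝[>] 0) (𝓝 (D 1 / I 1 * 1)) := by
      refine (hJ0.const_mul (D 1 / I 1)).congr' ?_
      filter_upwards [self_mem_nhdsWithin] with x hx using (hEk x hx).symm
    rw [← tendsto_nhds_unique h1 hE0, mul_one]
  rw [hDk y hy, hk0, zero_mul]

/-- The coefficients of `√y I₁(2√y)`. -/
def besselCoeff (n : ℕ) : ℝ := n / (n.factorial : ℝ) ^ 2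

/-- The coefficients of the non-logarithmic part of `2√y K₁(2√y)`, up to sign. -/
def besselLogCoeff (n : ℕ) : ℝ := (2 * n * (harmonic n : ℝ) - 1) / (n.factorial : ℝ) ^ 2

lemma harmonic_succ_cast (n : ℕ) : (harmonic (n + 1) : ℝ) = harmonic n + 1 / (n + 1) := by
  rw [harmonic_succ]
  push_cast
  rw [one_div]

lemma harmonic_cast_nonneg (n : ℕ) : (0 : ℝ) ≤ harmonic n := by
  induction n with
  | zero => simp
  | succ n ih =>
    rw [harmonic_succ_cast]
    positivity

lemma harmonic_cast_le (n : ℕ) : (harmonic n : ℝ) ≤ n := by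
  induction n with
  | zero => simp
  | succ n ih =>
    rw [harmonic_succ_cast]
    have : (1 : ℝ) / (n + 1) ≤ 1 := by
      rw [div_le_one (by positivity)]
      linarith [(n.cast_nonneg : (0 : ℝ) ≤ n)]
    push_cast
    linarith

lemma sq_le_two_mul_factorial (n : ℕ) : n ^ 2 ≤ 2 * n.factorial := by
  cases n with
  | zero => simp
  | succ n =>
    have h1 := n.self_le_factorial
    have h2 := n.factorial_pos
    rw [Nat.factorial_succ]
    nlinarith

lemma expBounded_besselCoeff : ExpBounded besselCoeff := by
  refine ⟨1, fun n => ?_⟩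
  have hf : (0 : ℝ) < n.factorial := by exact_mod_cast n.factorial_pos
  have h1 : (n : ℝ) ≤ n.factorial := by exact_mod_cast n.self_le_factorial
  rw [besselCoeff, abs_of_nonneg (by positivity), div_le_div_iff₀ (by positivity) hf]
  nlinarith

lemma expBounded_besselLogCoeff : ExpBounded besselLogCoeff := by
  refine ⟨5, fun n => ?_⟩
  have hf : (1 : ℝ) ≤ n.factorial := by exact_mod_cast n.factorial_pos
  have h1 : (n : ℝ) ^ 2 ≤ 2 * n.factorial := by exact_mod_cast sq_le_two_mul_factorial n
  have h2 := harmonic_cast_le n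
  have h3 := harmonic_cast_nonneg n
  -- The constant 5: `2n H_n ≤ 2n² ≤ 4 n!`, and the remaining 1 is at most `n!`.
  have h4 : |2 * n * (harmonic n : ℝ) - 1| ≤ 5 * n.factorial := by
    have h5 : 0 ≤ 2 * (n : ℝ) * harmonic n := by positivity
    have h6 : (n : ℝ) * harmonic n ≤ n * n := by gcongr
    rw [abs_le]
    constructor <;> nlinarith
  rw [besselLogCoeff, abs_div, abs_of_nonneg (by positivity : (0 : ℝ) ≤ (n.factorial : ℝ) ^ 2),
    div_le_div_iff₀ (by positivity) (by positivity)]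
  calc _ ≤ 5 * (n.factorial : ℝ) * n.factorial := by gcongr
    _ = _ := by ring

lemma mul_powerSum_derivCoeff_derivCoeff {a : ℕ → ℝ} (ha : ExpBounded a) (y : ℝ) :
    y * powerSum (derivCoeff (derivCoeff a)) y
      = ∑' n : ℕ, n * (n + 1) * a (n + 1) * y ^ n := by
  have hs := ha.derivCoeff.derivCoeff.summable y
  have hs' : Summable fun n : ℕ => (n : ℝ) * (n + 1) * a (n + 1) * y ^ n := by
    rw [← summable_nat_add_iff 1]
    refine (hs.mul_left y).congr fun n => ?_
    simp only [derivCoeff]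
    push_cast
    ring
  rw [powerSum, ← tsum_mul_left, hs'.tsum_eq_zero_add]
  simp only [Nat.cast_zero, zero_mul, zero_add]
  congr 1
  ext n
  simp only [derivCoeff]
  push_cast
  ring

/-- The coefficient recursion is `n(n+1) a_{n+1} = a_n`. -/
lemma mul_powerSum_derivCoeff_besselCoeff (y : ℝ) :
    y * powerSum (derivCoeff (derivCoeff besselCoeff)) y = powerSum besselCoeff y := by
  rw [mul_powerSum_derivCoeff_derivCoeff expBounded_besselCoeff, powerSum]
  congr 1
  ext n
  congr 1
  have hf : (n.factorial : ℝ) ≠ 0 := by exact_mod_cast n.factorial_ne_zero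
  rw [besselCoeff, besselCoeff, Nat.factorial_succ]
  push_cast
  field_simp

/-- With `I` the series of `besselCoeff`, `y (ln y · I)'' = ln y · I + 2I' - I/y`. The
non-logarithmic part must cancel the last two terms for the whole expansion to solve `y f'' = f`. -/
lemma mul_powerSum_derivCoeff_besselLogCoeff (y : ℝ) :
    y * powerSum (derivCoeff (derivCoeff besselLogCoeff)) y = powerSum besselLogCoeff y
      + 2 * powerSum (derivCoeff besselCoeff) y - powerSum (fun n => besselCoeff (n + 1)) y := by
  rw [mul_powerSum_derivCoeff_derivCoeff expBounded_besselLogCoeff, powerSum, powerSum, powerSum,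
    ← tsum_mul_left]
  have s1 := expBounded_besselLogCoeff.summable y
  have s2 := (expBounded_besselCoeff.derivCoeff.summable y).mul_left 2
  have s3 := expBounded_besselCoeff.shift.summable y
  rw [← s1.tsum_add s2, ← (s1.add s2).tsum_sub s3]
  congr 1
  ext n
  have hf : (n.factorial : ℝ) ≠ 0 := by exact_mod_cast n.factorial_ne_zero
  simp only [besselLogCoeff, derivCoeff, besselCoeff, Nat.factorial_succ, harmonic_succ_cast]
  push_cast
  field_simp
  ring

lemma powerSum_besselCoeff_pos {y : ℝ} (hy : 0 < y) : 0 < powerSum besselCoeff y := by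
  refine (expBounded_besselCoeff.summable y).tsum_pos (fun n => ?_) 1 ?_
  · unfold besselCoeff
    positivity
  · simp [besselCoeff, hy]

lemma powerSum_besselCoeff_div {y : ℝ} (hy : 0 < y) :
    powerSum besselCoeff y / y = powerSum (fun n => besselCoeff (n + 1)) y := by
  rw [div_eq_iff hy.ne', mul_comm, mul_powerSum_shift expBounded_besselCoeff]
  simp [besselCoeff]

/-- The expansion of `2√y K₁(2√y)` at `y = 0`. -/
lemma besselMoment_zero_eq_powerSum {y : ℝ} (hy : 0 < y) :
    besselMoment 0 y = (Real.log y + 2 * Real.eulerMascheroniConstant) * powerSum besselCoeff y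
      - powerSum besselLogCoeff y := by
  set γ := Real.eulerMascheroniConstant
  set I := powerSum besselCoeff with hI
  set J := powerSum (derivCoeff besselCoeff) with hJ
  set B := powerSum besselLogCoeff with hB
  set B' := powerSum (derivCoeff besselLogCoeff) with hB'
  have eI := expBounded_besselCoeff
  have eB := expBounded_besselLogCoeff
  have dI : ∀ y, HasDerivAt I (J y) y := fun y => hasDerivAt_powerSum eI y
  have dJ : ∀ y, 0 < y → HasDerivAt J (I y / y) y := fun y hy => by
    refine (hasDerivAt_powerSum eI.derivCoeff y).congr_deriv ?_
    rw [hI, ← mul_powerSum_derivCoeff_besselCoeff, mul_div_cancel_left₀ _ hy.ne']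
  have tI : Tendsto I (𝓝[>] 0) (𝓝 0) := by
    simpa [besselCoeff] using tendsto_powerSum eI
  have tJ : Tendsto J (𝓝[>] 0) (𝓝 1) := by
    simpa [besselCoeff, derivCoeff] using tendsto_powerSum eI.derivCoeff
  have tB : Tendsto B (𝓝[>] 0) (𝓝 (-1)) := by
    simpa [besselLogCoeff] using tendsto_powerSum eB
  have tB' : Tendsto B' (𝓝[>] 0) (𝓝 1) := by
    have := tendsto_powerSum eB.derivCoeff
    have e : derivCoeff besselLogCoeff 0 = 1 := by
      norm_num [besselLogCoeff, derivCoeff, harmonic_succ]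
    rwa [e] at this
  have tIy : Tendsto (fun y => I y / y) (𝓝[>] 0) (𝓝 1) := by
    have := tendsto_powerSum eI.shift
    simp only [besselCoeff] at this
    norm_num at this
    refine this.congr' ?_
    filter_upwards [self_mem_nhdsWithin] with y hy
    rw [hI, powerSum_besselCoeff_div hy]
    simp [besselCoeff]
  have tlI : Tendsto (fun y => Real.log y * I y) (𝓝[>] 0) (𝓝 0) := by
    simpa [besselCoeff] using tendsto_log_mul_powerSum_sub eI
  have tlJ : Tendsto (fun y => Real.log y * (J y - 1)) (𝓝[>] 0) (𝓝 0) := by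
    simpa [besselCoeff, derivCoeff] using tendsto_log_mul_powerSum_sub eI.derivCoeff
  have hlog : ∀ y : ℝ, 0 < y → HasDerivAt (fun y => Real.log y + 2 * γ) y⁻¹ y := fun y hy =>
    (Real.hasDerivAt_log hy.ne').add_const _
  have dS : ∀ y, 0 < y → HasDerivAt (fun y => (Real.log y + 2 * γ) * I y - B y)
      (I y / y + (Real.log y + 2 * γ) * J y - B' y) y := fun y hy => by
    refine (((hlog y hy).mul (dI y)).sub (hasDerivAt_powerSum eB y)).congr_deriv ?_
    rw [hB']
    ring
  have dS' : ∀ y, 0 < y → HasDerivAt (fun y => I y / y + (Real.log y + 2 * γ) * J y - B' y)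
      (((Real.log y + 2 * γ) * I y - B y) / y) y := fun y hy => by
    refine ((((dI y).div (hasDerivAt_id y) hy.ne').add ((hlog y hy).mul (dJ y hy))).sub
      (hasDerivAt_powerSum eB.derivCoeff y)).congr_deriv ?_
    have := mul_powerSum_derivCoeff_besselLogCoeff y
    rw [← powerSum_besselCoeff_div hy] at this
    have h2 : powerSum (derivCoeff (derivCoeff besselLogCoeff)) y
        = (B y + 2 * J y - I y / y) / y := by
      rw [← this, mul_div_cancel_left₀ _ hy.ne']
    rw [h2]
    simp only [id]
    field_simp
    ring
  have key := eq_zero_of_mul_deriv_deriv_eq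
    (D := fun y => besselMoment 0 y - ((Real.log y + 2 * γ) * I y - B y))
    (E := fun y => -besselMoment 1 y - (I y / y + (Real.log y + 2 * γ) * J y - B' y))
    (I := I) (J := J)
    (fun y hy => (hasDerivAt_besselMoment 0 hy).sub (dS y hy))
    (fun y hy => ((hasDerivAt_besselMoment 1 hy).neg.sub (dS' y hy)).congr_deriv (by
      rw [neg_neg, ← mul_besselMoment_two hy]
      field_simp))
    (fun y _ => dI y) dJ (fun y hy => powerSum_besselCoeff_pos hy) ?_ ?_ tI tJ hy
  · exact sub_eq_zero.1 key
  · have := tendsto_besselMoment_zero.sub ((tlI.add (tI.const_mul (2 * γ))).sub tB)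
    rw [show (1 : ℝ) - (0 + 2 * γ * 0 - -1) = 0 by ring] at this
    exact this.congr fun y => by ring
  -- The `-ln y` from `M₁` cancels against `ln y · J`, up to `ln y · (J - 1) → 0`; the constants
  -- `2γ` cancel as well.
  · have := ((tendsto_besselMoment_one_add_log.neg.sub (tJ.const_mul (2 * γ))).sub tlJ).sub
      (tIy.sub tB')
    rw [show - -(2 * γ) - 2 * γ * 1 - 0 - (1 - 1) = 0 by ring] at this
    exact this.congr fun y => by ring

/-- The expansion of `2√y K₁(2√y)` at `y = 0`, as a logarithmic series. -/
lemma hasSum_besselMoment_zero {y : ℝ} (hy : 0 < y) :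
    HasSum (fun l : ℕ => y ^ (l + 1) / (l.factorial * (l + 1).factorial)
      * (Real.log y + 2 * Real.eulerMascheroniConstant - harmonic l - harmonic (l + 1)))
      (besselMoment 0 y - 1) := by
  have h1 := ((expBounded_besselCoeff.summable y).hasSum.mul_left
    (Real.log y + 2 * Real.eulerMascheroniConstant)).sub
    (expBounded_besselLogCoeff.summable y).hasSum
  change HasSum _ ((Real.log y + 2 * Real.eulerMascheroniConstant) * powerSum besselCoeff y
      - powerSum besselLogCoeff y) at h1
  -- The term `n = 0` equals 1 and is split off, so index `l` carries the power `y^(l+1)`.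
  rw [← besselMoment_zero_eq_powerSum hy, ← hasSum_nat_add_iff' 1] at h1
  have e0 : ∑ n ∈ Finset.range 1, ((Real.log y + 2 * Real.eulerMascheroniConstant)
      * (besselCoeff n * y ^ n) - besselLogCoeff n * y ^ n) = 1 := by
    simp [besselCoeff, besselLogCoeff]
  rw [e0] at h1
  refine h1.congr_fun fun l => ?_
  have hf : (l.factorial : ℝ) ≠ 0 := by exact_mod_cast l.factorial_ne_zero
  simp only [besselLogCoeff, besselCoeff, Nat.factorial_succ, harmonic_succ_cast]
  push_cast
  field_simp
  ring

/-! ### Termwise integration against `e^{-sz}/(1+z)`. -/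

lemma integral_exp_neg_mul_pow {s : ℝ} (hs : 0 < s) (n : ℕ) :
    ∫ z in Ioi (0 : ℝ), Real.exp (-(s * z)) * z ^ n = n.factorial / s ^ (n + 1) := by
  have h := Real.integral_rpow_mul_exp_neg_mul_Ioi (a := n + 1) (by positivity) hs
  rw [Real.Gamma_nat_eq_factorial, add_sub_cancel_right] at h
  simp only [Real.rpow_natCast] at h
  rw [← Nat.cast_succ, Real.rpow_natCast] at h
  simp only [mul_comm (Real.exp _)]
  rw [h, one_div, inv_pow]
  field_simp

/-- A non-integrable function would have integral 0, but the computed value is positive. -/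
lemma integrableOn_exp_neg_mul_pow {s : ℝ} (hs : 0 < s) (n : ℕ) :
    IntegrableOn (fun z => Real.exp (-(s * z)) * z ^ n) (Ioi (0 : ℝ)) := by
  by_contra h
  have h1 := integral_exp_neg_mul_pow hs n
  rw [integral_undef h] at h1
  have : (0 : ℝ) < n.factorial / s ^ (n + 1) := by positivity
  exact this.ne h1

lemma abs_log_mul_pow_succ_le {z : ℝ} (hz : 0 < z) (l : ℕ) :
    |Real.log z| * z ^ (l + 1) ≤ z ^ (l + 2) + z ^ l := by
  have h1 : |Real.log z| * z ≤ z ^ 2 + 1 := by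
    rcases le_total 1 z with h | h
    · rw [abs_of_nonneg (Real.log_nonneg h)]
      nlinarith [Real.log_le_sub_one_of_pos hz]
    · have := (Real.abs_log_mul_self_lt z hz h).le
      rw [abs_mul, abs_of_pos hz] at this
      nlinarith
  calc |Real.log z| * z ^ (l + 1) = (|Real.log z| * z) * z ^ l := by ring
    _ ≤ (z ^ 2 + 1) * z ^ l := by gcongr
    _ = _ := by ring

lemma integrableOn_exp_mul_pow_mul_log_div {s : ℝ} (hs : 0 < s) (l : ℕ) :
    IntegrableOn (fun z => Real.exp (-(s * z)) * z ^ (l + 1) * Real.log z / (1 + z))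
      (Ioi (0 : ℝ)) := by
  refine Integrable.mono' ((integrableOn_exp_neg_mul_pow hs (l + 2)).add
    (integrableOn_exp_neg_mul_pow hs l)) (Measurable.aestronglyMeasurable (by fun_prop)) ?_
  filter_upwards [ae_restrict_mem measurableSet_Ioi] with z hz
  have hz : 0 < z := hz
  rw [norm_div, norm_mul, norm_mul, norm_pow, Real.norm_of_nonneg (Real.exp_pos _).le,
    Real.norm_of_nonneg hz.le, Real.norm_of_nonneg (by positivity : 0 ≤ 1 + z), Real.norm_eq_abs]
  refine (div_le_self (by positivity) (by linarith)).trans ?_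
  have := mul_le_mul_of_nonneg_left (abs_log_mul_pow_succ_le hz l) (Real.exp_pos (-(s * z))).le
  simp only [Pi.add_apply]
  linarith

lemma integrableOn_exp_mul_pow_div {s : ℝ} (hs : 0 < s) (n : ℕ) :
    IntegrableOn (fun z => Real.exp (-(s * z)) * z ^ n / (1 + z)) (Ioi (0 : ℝ)) := by
  refine Integrable.mono' (integrableOn_exp_neg_mul_pow hs n)
    (Measurable.aestronglyMeasurable (by fun_prop)) ?_
  filter_upwards [ae_restrict_mem measurableSet_Ioi] with z hz
  have hz : 0 < z := hz
  rw [Real.norm_of_nonneg (by positivity)]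
  exact div_le_self (by positivity) (by linarith)

lemma tricomiPsi_self (n : ℕ) (s : ℝ) :
    tricomiPsi (n + 1) (n + 1) s = (n.factorial : ℝ)⁻¹ *
      ∫ z in Ioi (0 : ℝ), Real.exp (-(s * z)) * z ^ n / (1 + z) := by
  rw [tricomiPsi, Real.Gamma_nat_eq_factorial]
  congr 1
  refine setIntegral_congr_fun measurableSet_Ioi fun z _ => ?_
  simp only [add_sub_cancel_right, Real.rpow_natCast, sub_self, zero_sub, Real.rpow_neg_one,
    div_eq_mul_inv]

/-- The integrand of the `l`-th term of the capacity series. -/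
def capacityTerm (s A : ℝ) (l : ℕ) (z : ℝ) : ℝ :=
  Real.exp (-(s * z)) / (1 + z) * ((A * z) ^ (l + 1) / (l.factorial * (l + 1).factorial)
    * (Real.log (A * z) + 2 * Real.eulerMascheroniConstant - harmonic l - harmonic (l + 1)))

lemma capacityTerm_eq {s A z : ℝ} (hA : 0 < A) (hz : 0 < z) (l : ℕ) :
    capacityTerm s A l z = A ^ (l + 1) / (l.factorial * (l + 1).factorial) *
      ((Real.log A + 2 * Real.eulerMascheroniConstant - harmonic l - harmonic (l + 1))
        * (Real.exp (-(s * z)) * z ^ (l + 1) / (1 + z))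
      + Real.exp (-(s * z)) * z ^ (l + 1) * Real.log z / (1 + z)) := by
  rw [capacityTerm, Real.log_mul hA.ne' hz.ne', mul_pow]
  ring

lemma integrableOn_capacityTerm {s A : ℝ} (hs : 0 < s) (hA : 0 < A) (l : ℕ) :
    IntegrableOn (capacityTerm s A l) (Ioi 0) := by
  refine IntegrableOn.congr_fun ?_ (fun z hz => (capacityTerm_eq hA hz l).symm) measurableSet_Ioi
  exact (((integrableOn_exp_mul_pow_div hs (l + 1)).const_mul _).add
    (integrableOn_exp_mul_pow_mul_log_div hs l)).const_mul _

lemma integral_capacityTerm {s A : ℝ} (hs : 0 < s) (hA : 0 < A) (l : ℕ) :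
    ∫ z in Ioi (0 : ℝ), capacityTerm s A l z = A ^ (l + 1) / l.factorial *
      ((Real.log A + 2 * Real.eulerMascheroniConstant - harmonic l - harmonic (l + 1))
        * tricomiPsi (l + 2) (l + 2) s
      + 1 / (l + 1).factorial *
        ∫ z in Ioi (0 : ℝ), Real.exp (-(s * z)) * z ^ (l + 1) * Real.log z / (1 + z)) := by
  rw [setIntegral_congr_fun measurableSet_Ioi fun z hz => capacityTerm_eq hA hz l,
    integral_const_mul, integral_add ((integrableOn_exp_mul_pow_div hs (l + 1)).const_mul _)
    (integrableOn_exp_mul_pow_mul_log_div hs l), integral_const_mul]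
  have e := tricomiPsi_self (l + 1) s
  rw [Nat.cast_succ, add_assoc, one_add_one_eq_two] at e
  rw [e]
  have hf : (l.factorial : ℝ) ≠ 0 := by exact_mod_cast l.factorial_ne_zero
  have hf' : ((l + 1).factorial : ℝ) ≠ 0 := by exact_mod_cast (l + 1).factorial_ne_zero
  field_simp

/-- Integrating the powers of `z` produces a factorial that cancels only one of the two in the
denominator, up to factors polynomial in `l`. Those, including the bound `2l + 1` on the harmonic
numbers, are absorbed by `l + 1 ≤ 2^l`, leaving an exponential series in `2A/s`. -/
lemma summable_integral_norm_capacityTerm {s A : ℝ} (hs : 0 < s) (hA : 0 < A) :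
    Summable fun l : ℕ => ∫ z in Ioi (0 : ℝ), ‖capacityTerm s A l z‖ := by
  set M := |Real.log A + 2 * Real.eulerMascheroniConstant| with hM
  have hM0 : 0 ≤ M := abs_nonneg _
  have hsum : Summable fun l : ℕ =>
      A / s * ((M + 2) / s + 2 / s ^ 2 + 1) * ((2 * (A / s)) ^ l / l.factorial) :=
    (Real.summable_pow_div_factorial _).mul_left _
  refine Summable.of_nonneg_of_le (fun l => integral_nonneg fun z => norm_nonneg _) (fun l => ?_)
    hsum
  have hf : (0 : ℝ) < l.factorial := by exact_mod_cast l.factorial_pos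
  set C := A ^ (l + 1) / (l.factorial * (l + 1).factorial) with hC
  have hC0 : 0 ≤ C := by positivity
  have i1 := integrableOn_exp_neg_mul_pow hs (l + 1)
  have i2 := integrableOn_exp_neg_mul_pow hs (l + 2)
  have i0 := integrableOn_exp_neg_mul_pow hs l
  have i20 : IntegrableOn (fun z => Real.exp (-(s * z)) * z ^ (l + 2) + Real.exp (-(s * z)) * z ^ l)
      (Ioi 0) := i2.add i0
  have hle : ∫ z in Ioi (0 : ℝ), ‖capacityTerm s A l z‖ ≤ ∫ z in Ioi (0 : ℝ),
      C * ((M + (2 * l + 1)) * (Real.exp (-(s * z)) * z ^ (l + 1))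
        + (Real.exp (-(s * z)) * z ^ (l + 2) + Real.exp (-(s * z)) * z ^ l)) := by
    refine setIntegral_mono_on (integrableOn_capacityTerm hs hA l).norm
      (((i1.const_mul _).add i20).const_mul _) measurableSet_Ioi fun z hz => ?_
    have hz : 0 < z := hz
    rw [capacityTerm_eq hA hz, norm_mul, Real.norm_of_nonneg hC0]
    gcongr
    refine (norm_add_le _ _).trans (add_le_add ?_ ?_)
    · rw [norm_mul]
      gcongr
      · rw [Real.norm_eq_abs, sub_sub]
        refine (abs_sub _ _).trans (add_le_add le_rfl ?_)
        have h1 := harmonic_cast_nonneg l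
        have h2 := harmonic_cast_nonneg (l + 1)
        have h3 := harmonic_cast_le l
        have h4 := harmonic_cast_le (l + 1)
        rw [abs_of_nonneg (by positivity)]
        push_cast at h4
        linarith
      · rw [Real.norm_of_nonneg (by positivity)]
        exact div_le_self (by positivity) (by linarith)
    · rw [norm_div, norm_mul, norm_mul, norm_pow, Real.norm_of_nonneg (Real.exp_pos _).le,
        Real.norm_of_nonneg hz.le, Real.norm_of_nonneg (by positivity : 0 ≤ 1 + z),
        Real.norm_eq_abs]
      refine (div_le_self (by positivity) (by linarith)).trans ?_
      have := mul_le_mul_of_nonneg_left (abs_log_mul_pow_succ_le hz l)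
        (Real.exp_pos (-(s * z))).le
      linarith
  refine hle.trans ?_
  rw [integral_const_mul, integral_add (i1.const_mul _) i20, integral_const_mul,
    integral_add i2 i0, integral_exp_neg_mul_pow hs, integral_exp_neg_mul_pow hs,
    integral_exp_neg_mul_pow hs]
  have h2l : (l : ℝ) + 1 ≤ 2 ^ l := by exact_mod_cast Nat.lt_two_pow_self
  have hl0 : (0 : ℝ) ≤ l := l.cast_nonneg
  have e : C * ((M + (2 * l + 1)) * ((l + 1).factorial / s ^ (l + 1 + 1))
      + ((l + 2).factorial / s ^ (l + 2 + 1) + l.factorial / s ^ (l + 1)))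
      = A / s * ((M + (2 * l + 1)) / s + (l + 2) / s ^ 2 + 1 / (l + 1))
        * ((A / s) ^ l / l.factorial) := by
    rw [hC, Nat.factorial_succ (l + 1), Nat.factorial_succ l]
    push_cast
    rw [div_pow]
    field_simp
    ring
  rw [e]
  calc _ ≤ A / s * (((M + 2) * 2 ^ l) / s + (2 * 2 ^ l) / s ^ 2 + 2 ^ l)
        * ((A / s) ^ l / l.factorial) := by
        gcongr
        · nlinarith
        · linarith
        · rw [div_le_iff₀ (by positivity)]
          nlinarith
    _ = _ := by
        rw [mul_pow]
        ring

lemma besselMoment_zero_nonneg (y : ℝ) : 0 ≤ besselMoment 0 y :=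
  integral_nonneg fun u => by simp [Real.exp_nonneg]

lemma besselMoment_zero_le_one {y : ℝ} (hy : 0 < y) : besselMoment 0 y ≤ 1 := by
  rw [← integral_exp_neg_Ioi_zero, besselMoment]
  refine setIntegral_mono_on (integrableOn_besselMoment 0 hy) integrableOn_exp_neg_Ioi_zero
    measurableSet_Ioi fun u hu => ?_
  simpa using exp_sub_div_le_exp_neg hy.le hu

lemma integrableOn_exp_div_mul_besselMoment {s A : ℝ} (hs : 0 < s) (hA : 0 < A) :
    IntegrableOn (fun z => Real.exp (-(s * z)) / (1 + z) * besselMoment 0 (A * z)) (Ioi 0) := by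
  have h0 : IntegrableOn (fun z => Real.exp (-(s * z)) / (1 + z)) (Ioi 0) := by
    simpa using integrableOn_exp_mul_pow_div hs 0
  have hc : ContinuousOn (fun z => besselMoment 0 (A * z)) (Ioi 0) := fun z hz => by
    have hz : 0 < A * z := mul_pos hA hz
    exact (ContinuousAt.comp (f := fun z => A * z) (hasDerivAt_besselMoment 0 hz).continuousAt
      (by fun_prop)).continuousWithinAt
  refine Integrable.mono' h0
    (h0.aestronglyMeasurable.mul (hc.aestronglyMeasurable measurableSet_Ioi)) ?_
  filter_upwards [ae_restrict_mem measurableSet_Ioi] with z hz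
  have hz : 0 < z := hz
  have h1 := besselMoment_zero_nonneg (A * z)
  rw [Real.norm_of_nonneg (by positivity)]
  exact mul_le_of_le_one_right (by positivity) (besselMoment_zero_le_one (mul_pos hA hz))

lemma hasSum_integral_capacityTerm {s A : ℝ} (hs : 0 < s) (hA : 0 < A) :
    HasSum (fun l : ℕ => ∫ z in Ioi (0 : ℝ), capacityTerm s A l z)
      ((∫ z in Ioi (0 : ℝ), Real.exp (-(s * z)) / (1 + z) * besselMoment 0 (A * z))
        - tricomiPsi 1 1 s) := by
  have h := hasSum_integral_of_summable_integral_norm (integrableOn_capacityTerm hs hA)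
    (summable_integral_norm_capacityTerm hs hA)
  have h0 : IntegrableOn (fun z => Real.exp (-(s * z)) / (1 + z)) (Ioi 0) := by
    simpa using integrableOn_exp_mul_pow_div hs 0
  have e := tricomiPsi_self 0 s
  simp only [Nat.cast_zero, zero_add, Nat.factorial_zero, Nat.cast_one, inv_one, one_mul, pow_zero,
    mul_one] at e
  rw [e, ← integral_sub (integrableOn_exp_div_mul_besselMoment hs hA) h0]
  rwa [← setIntegral_congr_fun measurableSet_Ioi fun z hz => ?_] at h
  have := (hasSum_besselMoment_zero (mul_pos hA hz)).mul_left (Real.exp (-(s * z)) / (1 + z))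
  refine Eq.trans ?_ this.tsum_eq.symm
  ring

/-! ### The squared modulus of a complex Gaussian. -/

lemma gaussianPDF_mul_gaussianPDF_polar {v : ℝ≥0} (hv : 0 < v) (r θ : ℝ) :
    gaussianPDF 0 (v / 2) (r * Real.cos θ) * gaussianPDF 0 (v / 2) (r * Real.sin θ)
      = ENNReal.ofReal (Real.exp (-(r ^ 2 / v)) / (Real.pi * v)) := by
  have hv' : (0 : ℝ) < v := hv
  have hπ := Real.pi_pos
  rw [gaussianPDF_def, ← ENNReal.ofReal_mul (gaussianPDFReal_nonneg _ _ _)]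
  congr 1
  simp only [gaussianPDFReal, sub_zero, NNReal.coe_div, NNReal.coe_ofNat]
  have e : 2 * Real.pi * ((v : ℝ) / 2) = Real.pi * v := by ring
  rw [e, mul_mul_mul_comm, ← Real.exp_add, ← mul_inv, Real.mul_self_sqrt (by positivity),
    div_eq_inv_mul (Real.exp (-(r ^ 2 / v)))]
  congr 2
  have := Real.cos_sq_add_sin_sq θ
  field_simp
  linear_combination (-(r ^ 2)) * this

/-- The squared modulus of a `CN(0, v)` variable is exponential with mean `v`. -/
lemma lintegral_norm_sq_complexGaussian {v : ℝ≥0} (hv : 0 < v) {f : ℝ → ENNReal}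
    (hf : Measurable f) :
    ∫⁻ z, f (‖z‖ ^ 2) ∂complexGaussian v
      = ∫⁻ x in Ioi (0 : ℝ), ENNReal.ofReal (Real.exp (-(x / v)) / v) * f x := by
  have hv' : (0 : ℝ) < v := hv
  have hπ := Real.pi_pos
  have hv2 : v / 2 ≠ 0 := (half_pos hv).ne'
  have hm := measurable_gaussianPDF 0 (v / 2)
  have hg : Measurable fun p : ℝ × ℝ => f (p.1 ^ 2 + p.2 ^ 2) := by fun_prop
  rw [complexGaussian, lintegral_map_equiv, gaussianReal_of_var_ne_zero _ hv2,
    prod_withDensity hm hm]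
  have e1 : ∀ p : ℝ × ℝ, ‖Complex.measurableEquivRealProd.symm p‖ ^ 2 = p.1 ^ 2 + p.2 ^ 2 :=
    fun p => by
      rw [Complex.sq_norm, Complex.normSq_apply, Complex.measurableEquivRealProd_symm_apply]
      ring
  simp only [e1]
  rw [lintegral_withDensity_eq_lintegral_mul _ (by fun_prop) hg, ← Measure.volume_eq_prod,
    ← lintegral_comp_polarCoord_symm, polarCoord_target]
  have e2 : ∀ p : ℝ × ℝ, ENNReal.ofReal p.1 •
      ((fun z : ℝ × ℝ => gaussianPDF 0 (v / 2) z.1 * gaussianPDF 0 (v / 2) z.2)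
        * fun p : ℝ × ℝ => f (p.1 ^ 2 + p.2 ^ 2)) (polarCoord.symm p)
      = ENNReal.ofReal p.1 * (ENNReal.ofReal (Real.exp (-(p.1 ^ 2 / v)) / (Real.pi * v))
        * f (p.1 ^ 2)) := fun p => by
    have : (p.1 * Real.cos p.2) ^ 2 + (p.1 * Real.sin p.2) ^ 2 = p.1 ^ 2 := by
      linear_combination p.1 ^ 2 * Real.cos_sq_add_sin_sq p.2
    simp only [polarCoord_symm_apply, Pi.mul_apply, smul_eq_mul,
      gaussianPDF_mul_gaussianPDF_polar hv, this]
  simp only [e2]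
  rw [Measure.volume_eq_prod, ← Measure.prod_restrict, lintegral_prod _ (by fun_prop)]
  simp only [lintegral_const, Measure.restrict_apply MeasurableSet.univ, univ_inter,
    Real.volume_Ioo]
  -- The angle contributes the length `2π`; the radial integral is matched by substituting `x = r²`
  -- on the exponential side.
  have e3 : (fun x : ℝ => x ^ 2) '' Ioi 0 = Ioi 0 := by
    ext x
    simp only [mem_image, mem_Ioi]
    constructor
    · rintro ⟨y, hy, rfl⟩
      positivity
    · exact fun hx => ⟨√x, Real.sqrt_pos.2 hx, Real.sq_sqrt hx.le⟩
  have e4 := lintegral_image_eq_lintegral_abs_deriv_mul (s := Ioi (0 : ℝ)) (f := fun x => x ^ 2)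
    (f' := fun x => 2 * x) measurableSet_Ioi
    (fun x _ => by simpa using (hasDerivAt_pow 2 x).hasDerivWithinAt)
    (fun x hx y hy h => by
      have hx : 0 < x := hx
      have hy : 0 < y := hy
      exact (pow_left_inj₀ hx.le hy.le two_ne_zero).1 h)
    (fun x => ENNReal.ofReal (Real.exp (-(x / v)) / v) * f x)
  rw [e3] at e4
  rw [e4]
  refine setLIntegral_congr_fun measurableSet_Ioi fun r hr => ?_
  have hr : 0 < r := hr
  rw [abs_of_pos (by positivity : 0 < 2 * r), ← mul_assoc, ← mul_assoc, mul_right_comm,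
    ← ENNReal.ofReal_mul hr.le, ← ENNReal.ofReal_mul (by positivity),
    ← ENNReal.ofReal_mul (by positivity)]
  congr 2
  field_simp
  ring

instance (v : ℝ≥0) : IsProbabilityMeasure (complexGaussian v) :=
  Measure.isProbabilityMeasure_map Complex.measurableEquivRealProd.symm.measurable.aemeasurable

lemma complexGaussian_lt_norm_sq {v : ℝ≥0} (hv : 0 < v) {t : ℝ} (ht : 0 ≤ t) :
    complexGaussian v {z | t < ‖z‖ ^ 2} = ENNReal.ofReal (Real.exp (-(t / v))) := by
  have hv' : (0 : ℝ) < v := hv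
  have hs : MeasurableSet {z : ℂ | t < ‖z‖ ^ 2} := measurableSet_lt (by fun_prop) (by fun_prop)
  have h1 := lintegral_norm_sq_complexGaussian hv
    (f := (Ioi t).indicator 1) (measurable_one.indicator measurableSet_Ioi)
  have h2 : ∫⁻ z, (Ioi t).indicator (1 : ℝ → ENNReal) (‖z‖ ^ 2) ∂complexGaussian v
      = complexGaussian v {z | t < ‖z‖ ^ 2} := by
    rw [← lintegral_indicator_one hs]
    rfl
  have h3 : ∀ x : ℝ, ENNReal.ofReal (Real.exp (-(x / v)) / v) * (Ioi t).indicator 1 x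
      = (Ioi t).indicator (fun x => ENNReal.ofReal (Real.exp (-(x / v)) / v)) x := fun x => by
    by_cases hx : x ∈ Ioi t <;> simp [hx]
  rw [← h2, h1]
  simp only [h3]
  rw [lintegral_indicator measurableSet_Ioi, Measure.restrict_restrict measurableSet_Ioi,
    inter_eq_left.2 (Ioi_subset_Ioi ht)]
  have hc : (fun x : ℝ => Real.exp (-(x / v)) / v) = fun x => Real.exp (-(v : ℝ)⁻¹ * x) / v := by
    ext x
    congr 2
    ring
  have hi : IntegrableOn (fun x : ℝ => Real.exp (-(x / v)) / v) (Ioi t) := by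
    rw [hc]
    exact (integrableOn_exp_mul_Ioi (by simpa using hv') t).div_const _
  rw [← ofReal_integral_eq_lintegral_ofReal hi (Eventually.of_forall fun x => by positivity), hc,
    integral_div, integral_exp_mul_Ioi (by simpa using hv')]
  congr 1
  rw [show -(v : ℝ)⁻¹ * t = -(t / v) by ring]
  field_simp

/-! ### Tail of the SNR and the expected rate. -/

namespace TwoWayRelay

variable (T : TwoWayRelay)

lemma var_pos : 0 < T.var := T.noise_pos

lemma b_pos : 0 < T.b := by
  have h1 := T.noise_pos
  have h2 := T.varB_nonneg
  have h3 := T.lam_pos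
  have h4 : 0 < 1 - T.lam := sub_pos.2 T.lam_lt_one
  unfold b eps
  positivity

lemma c_pos : 0 < T.c := by
  have h1 := T.eta_pos
  have h3 := T.lam_pos
  unfold c
  positivity

lemma psiArg_pos (i : Fin 2) : 0 < T.psiArg i := by
  have h1 := T.var_pos
  have h2 := T.b_pos
  have h3 := T.P_pos i
  have h4 : (0 : ℝ) < T.chanVar i := T.chanVar_pos i
  unfold psiArg
  positivity

lemma ratio_pos (i : Fin 2) : 0 < T.ratio i := by
  have h1 := T.var_pos
  have h2 := T.c_pos
  have h3 := T.P_pos i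
  have h4 : (0 : ℝ) < T.chanVar 0 := T.chanVar_pos 0
  have h5 : (0 : ℝ) < T.chanVar 1 := T.chanVar_pos 1
  unfold ratio
  positivity

lemma snr_nonneg (i : Fin 2) (h : Fin 2 → ℂ) : 0 ≤ T.snr i h := by
  have h1 := T.var_pos
  have h2 := T.c_pos
  have h3 := T.P_pos (1 - i)
  have h4 := T.b_pos
  rw [snr_eq]
  positivity

lemma ratio_eq (i : Fin 2) :
    T.ratio (1 - i) = T.var * T.c / (T.P (1 - i) * T.chanVar i * T.chanVar (1 - i)) := by
  unfold ratio
  fin_cases i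
  · simp
  · simp [mul_right_comm]

variable {S : Type*} [MeasurableSpace S] {μ : Measure S} {h : Fin 2 → S → ℂ}

lemma aemeasurable_snr (hm : ∀ i, AEMeasurable (h i) μ) (i : Fin 2) :
    AEMeasurable (fun ω => T.snr i fun k => h k ω) μ := by
  simp only [snr_eq]
  have h1 := hm i
  have h2 := hm (1 - i)
  fun_prop

variable [IsProbabilityMeasure μ]

/-- The complementary distribution function of the SNR. -/
lemma measure_lt_snr (hlaw : ∀ i, HasLaw (h i) (complexGaussian (T.chanVar i)) μ)
    (hindep : IndepFun (h 0) (h 1) μ) (i : Fin 2) {t : ℝ} (ht : 0 < t) :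
    μ {ω | t < T.snr i fun k => h k ω} = ENNReal.ofReal
      (Real.exp (-(T.psiArg (1 - i) * t)) * besselMoment 0 (T.ratio (1 - i) * t)) := by
  have h1 := T.var_pos
  have h2 := T.c_pos
  have h3 := T.P_pos (1 - i)
  have h4 := T.b_pos
  have hv : (0 : ℝ) < T.chanVar i := T.chanVar_pos i
  have hw : (0 : ℝ) < T.chanVar (1 - i) := T.chanVar_pos (1 - i)
  have hind : IndepFun (h i) (h (1 - i)) μ := by
    fin_cases i
    · exact hindep
    · exact hindep.symm
  have hpair := hind.hasLaw_prod (hlaw i) (hlaw (1 - i))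
  set F : ℝ × ℝ → ℝ := fun p => T.P (1 - i) / T.var * (p.1 * p.2 / (T.b * p.1 + T.c)) with hF
  have hFm : Measurable F := by fun_prop
  set U : Set (ℝ × ℂ) := {p | t < F (p.1, ‖p.2‖ ^ 2)} with hU
  have hUm : MeasurableSet U := measurableSet_lt (by fun_prop) (by fun_prop)
  set V : Set (ℂ × ℂ) := {p | t < F (‖p.1‖ ^ 2, ‖p.2‖ ^ 2)} with hV
  have hVm : MeasurableSet V := measurableSet_lt (by fun_prop) (by fun_prop)
  have e1 : μ {ω | t < T.snr i fun k => h k ω}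
      = ((complexGaussian (T.chanVar i)).prod (complexGaussian (T.chanVar (1 - i)))) V := by
    rw [← hpair.map_eq, Measure.map_apply_of_aemeasurable hpair.aemeasurable hVm]
    simp only [snr_eq]
    rfl
  have e2 : ∀ a : ℂ, Prod.mk a ⁻¹' V = Prod.mk (‖a‖ ^ 2) ⁻¹' U := fun a => rfl
  rw [e1, Measure.prod_apply hVm]
  simp only [e2]
  rw [lintegral_norm_sq_complexGaussian (T.chanVar_pos i)
    (f := fun x => complexGaussian (T.chanVar (1 - i)) (Prod.mk x ⁻¹' U))
    (measurable_measure_prodMk_left hUm)]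
  -- Given `|h_i|² = x`, the event is a lower bound on `|h_j|²`, whose exponential tail is explicit.
  have e3 : ∀ x : ℝ, 0 < x → complexGaussian (T.chanVar (1 - i)) (Prod.mk x ⁻¹' U)
      = ENNReal.ofReal (Real.exp (-(t * T.var * (T.b * x + T.c) / (T.P (1 - i) * x)
          / T.chanVar (1 - i)))) := fun x hx => by
    rw [← complexGaussian_lt_norm_sq (T.chanVar_pos (1 - i)) (by positivity)]
    congr 1
    ext z
    change t < T.P (1 - i) / T.var * (x * ‖z‖ ^ 2 / (T.b * x + T.c)) ↔ _ < ‖z‖ ^ 2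
    have e : T.P (1 - i) / T.var * (x * ‖z‖ ^ 2 / (T.b * x + T.c))
        = T.P (1 - i) * x * ‖z‖ ^ 2 / (T.var * (T.b * x + T.c)) := by
      field_simp
    rw [e, lt_div_iff₀ (by positivity), div_lt_iff₀ (by positivity)]
    constructor <;> intro h <;> linarith
  -- The integrand after the scaling `x = Ω_i u`. The part of the threshold constant in `x` gives
  -- `e^{-s_j t}`, the part in `1/x` gives `e^{-A_j t/u}`.
  set G : ℝ → ℝ := fun u => Real.exp (-(T.psiArg (1 - i) * t))
    * Real.exp (-u - T.ratio (1 - i) * t / u) with hG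
  have hGi : IntegrableOn G (Ioi 0) := by
    have := integrableOn_besselMoment 0 (mul_pos (T.ratio_pos (1 - i)) ht)
    simp only [pow_zero, div_one] at this
    exact this.const_mul _
  have e4 : ∫⁻ x in Ioi (0 : ℝ), ENNReal.ofReal (Real.exp (-(x / T.chanVar i)) / T.chanVar i)
        * complexGaussian (T.chanVar (1 - i)) (Prod.mk x ⁻¹' U)
      = ∫⁻ x in Ioi (0 : ℝ),
        ENNReal.ofReal ((T.chanVar i : ℝ)⁻¹ * G ((T.chanVar i : ℝ)⁻¹ * x)) := by
    refine setLIntegral_congr_fun measurableSet_Ioi fun x hx => ?_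
    have hx : 0 < x := hx
    rw [e3 x hx, ← ENNReal.ofReal_mul (by positivity)]
    congr 1
    rw [hG, div_eq_inv_mul, mul_assoc]
    simp only
    rw [← Real.exp_add, ← Real.exp_add]
    congr 2
    rw [ratio_eq, psiArg]
    field_simp
    ring
  have hGi' : IntegrableOn (fun x => (T.chanVar i : ℝ)⁻¹ * G ((T.chanVar i : ℝ)⁻¹ * x))
      (Ioi 0) := by
    have := (integrableOn_Ioi_comp_mul_left_iff G 0 (inv_pos.2 hv)).2 (by simpa using hGi)
    exact this.const_mul _
  rw [e4, ← ofReal_integral_eq_lintegral_ofReal hGi'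
    (Eventually.of_forall fun x => by simp only [hG, Pi.zero_apply]; positivity)]
  congr 1
  rw [integral_const_mul, integral_comp_mul_left_Ioi _ _ (inv_pos.2 hv), mul_zero, inv_inv,
    smul_eq_mul, inv_mul_cancel_left₀ hv.ne', hG, integral_const_mul]
  simp [besselMoment]

lemma integral_inv_one_add {x : ℝ} (hx : 0 ≤ x) :
    ∫ t in (0 : ℝ)..x, (1 + t)⁻¹ = Real.log (1 + x) := by
  have h0 : ∀ t ∈ uIcc 0 x, 0 < 1 + t := fun t ht => by
    rw [uIcc_of_le hx] at ht
    linarith [ht.1]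
  rw [intervalIntegral.integral_eq_sub_of_hasDerivAt (f := fun t => Real.log (1 + t))
    (fun t ht => ?_) ?_]
  · simp
  · refine ContinuousOn.intervalIntegrable fun t ht => ?_
    exact (ContinuousAt.inv₀ (by fun_prop) (h0 t ht).ne').continuousWithinAt
  · simpa using ((hasDerivAt_id t).const_add 1).log (h0 t ht).ne'

/-- Layer-cake formula with weight `1/(1+t)`, whose primitive is `ln(1+t)`. The extended-real form
yields finiteness and the value at once. -/
lemma lintegral_log_one_add_snr (hlaw : ∀ i, HasLaw (h i) (complexGaussian (T.chanVar i)) μ)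
    (hindep : IndepFun (h 0) (h 1) μ) (i : Fin 2) :
    ∫⁻ ω, ENNReal.ofReal (Real.log (1 + T.snr i fun k => h k ω)) ∂μ
      = ENNReal.ofReal (∫ z in Ioi (0 : ℝ), Real.exp (-(T.psiArg (1 - i) * z)) / (1 + z)
          * besselMoment 0 (T.ratio (1 - i) * z)) := by
  have h1 := lintegral_comp_eq_lintegral_meas_lt_mul (g := fun t => (1 + t)⁻¹) μ
    (Eventually.of_forall fun ω => T.snr_nonneg i fun k => h k ω)
    (T.aemeasurable_snr (fun i => (hlaw i).aemeasurable) i) (fun t ht => ?_) ?_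
  · simp only [integral_inv_one_add (T.snr_nonneg i _)] at h1
    rw [h1, ofReal_integral_eq_lintegral_ofReal
      (integrableOn_exp_div_mul_besselMoment (T.psiArg_pos _) (T.ratio_pos _))]
    · refine setLIntegral_congr_fun measurableSet_Ioi fun z hz => ?_
      have hz : 0 < z := hz
      have := besselMoment_zero_nonneg (T.ratio (1 - i) * z)
      rw [T.measure_lt_snr hlaw hindep i hz, ← ENNReal.ofReal_mul (by positivity)]
      congr 1
      ring
    · filter_upwards [ae_restrict_mem measurableSet_Ioi] with z hz
      have hz : 0 < z := hz
      have := besselMoment_zero_nonneg (T.ratio (1 - i) * z)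
      simp only [Pi.zero_apply]
      positivity
  · refine ContinuousOn.intervalIntegrable fun x hx => ?_
    rw [uIcc_of_le ht.le] at hx
    have : 1 + x ≠ 0 := by linarith [hx.1]
    exact (ContinuousAt.inv₀ (by fun_prop) this).continuousWithinAt
  · filter_upwards [ae_restrict_mem measurableSet_Ioi] with z hz
    have hz : 0 < z := hz
    positivity

lemma rate_eq (i : Fin 2) (g : Fin 2 → ℂ) :
    T.rate i g = 1 / (2 * Real.log 2) * Real.log (1 + T.snr i g) := by
  rw [rate, Real.logb]
  ring

lemma integrable_log_one_add_snr (hlaw : ∀ i, HasLaw (h i) (complexGaussian (T.chanVar i)) μ)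
    (hindep : IndepFun (h 0) (h 1) μ) (i : Fin 2) :
    Integrable (fun ω => Real.log (1 + T.snr i fun k => h k ω)) μ := by
  have hm := T.aemeasurable_snr (fun i => (hlaw i).aemeasurable) i
  refine ⟨(Real.measurable_log.comp_aemeasurable (hm.const_add 1)).aestronglyMeasurable, ?_⟩
  rw [hasFiniteIntegral_iff_ofReal (Eventually.of_forall fun ω =>
    Real.log_nonneg (by linarith [T.snr_nonneg i fun k => h k ω])),
    T.lintegral_log_one_add_snr hlaw hindep]
  exact ENNReal.ofReal_lt_top

lemma integral_log_one_add_snr (hlaw : ∀ i, HasLaw (h i) (complexGaussian (T.chanVar i)) μ)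
    (hindep : IndepFun (h 0) (h 1) μ) (i : Fin 2) :
    ∫ ω, Real.log (1 + T.snr i fun k => h k ω) ∂μ
      = ∫ z in Ioi (0 : ℝ), Real.exp (-(T.psiArg (1 - i) * z)) / (1 + z)
          * besselMoment 0 (T.ratio (1 - i) * z) := by
  rw [integral_eq_lintegral_of_nonneg_ae (Eventually.of_forall fun ω =>
    Real.log_nonneg (by linarith [T.snr_nonneg i fun k => h k ω]))
    (T.integrable_log_one_add_snr hlaw hindep i).aestronglyMeasurable,
    T.lintegral_log_one_add_snr hlaw hindep, ENNReal.toReal_ofReal]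
  refine setIntegral_nonneg measurableSet_Ioi fun z hz => ?_
  have hz : 0 < z := hz
  have := besselMoment_zero_nonneg (T.ratio (1 - i) * z)
  positivity

lemma integral_capacityTerm_eq_seriesTerm (i : Fin 2) (l : ℕ) :
    ∫ z in Ioi (0 : ℝ), capacityTerm (T.psiArg i) (T.ratio i) l z = T.seriesTerm i l := by
  have hH : ∀ n : ℕ, (harmonic n : ℝ) = ∑ k ∈ Finset.Icc 1 n, 1 / (k : ℝ) := fun n => by
    rw [harmonic_eq_sum_Icc]
    simp
  rw [integral_capacityTerm (T.psiArg_pos i) (T.ratio_pos i), hH, hH]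
  rfl

end TwoWayRelay

end

theorem theorem2 {S : Type*} [MeasurableSpace S] (μ : Measure S) [IsProbabilityMeasure μ]
    (T : TwoWayRelay) (h : Fin 2 → S → ℂ)
    (hlaw : ∀ i, HasLaw (h i) (complexGaussian (T.chanVar i)) μ)
    (hindep : IndepFun (h 0) (h 1) μ) :
    (∀ i, Integrable (fun ω => T.rate i (fun k => h k ω)) μ) ∧
    (∀ i l, IntegrableOn (T.residualIntegrand i l) (Set.Ioi 0)) ∧
    (∀ i, Summable (fun l : ℕ => T.seriesTerm i (l + 1))) ∧
    T.ergodicCapacity μ h =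
      1 / (2 * Real.log 2) * ∑ i : Fin 2, tricomiPsi 1 1 (T.psiArg i)
      + 1 / (2 * Real.log 2) * ∑ i : Fin 2,
          ((∑' l : ℕ, T.seriesTerm i (l + 1))
            + T.ratio i * (Real.log (T.ratio i) + 2 * Real.eulerMascheroniConstant - 1)
                * tricomiPsi 2 2 (T.psiArg i)
            + T.ratio i * T.residualIntegral i 0) := by
  have hsum : ∀ i, HasSum (T.seriesTerm i)
      ((∫ z in Set.Ioi (0 : ℝ), Real.exp (-(T.psiArg i * z)) / (1 + z)
        * besselMoment 0 (T.ratio i * z)) - tricomiPsi 1 1 (T.psiArg i)) := fun i =>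
    (hasSum_integral_capacityTerm (T.psiArg_pos i) (T.ratio_pos i)).congr_fun fun l =>
      (T.integral_capacityTerm_eq_seriesTerm i l).symm
  -- The rate at one source depends on the other's power, hence the index `1 - i`; the swap
  -- disappears in the sum over both sources.
  have hrate : ∀ i, ∫ ω, T.rate i (fun k => h k ω) ∂μ = 1 / (2 * Real.log 2) *
      (tricomiPsi 1 1 (T.psiArg (1 - i)) + (T.seriesTerm (1 - i) 0
        + ∑' l : ℕ, T.seriesTerm (1 - i) (l + 1))) := fun i => by
    have hs := hsum (1 - i)
    simp only [T.rate_eq]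
    rw [integral_const_mul, T.integral_log_one_add_snr hlaw hindep,
      ← hs.summable.tsum_eq_zero_add, hs.tsum_eq, add_sub_cancel]
  -- At `l = 0` the harmonic sums are 0 and 1, which accounts for the `-1`.
  have hzero : ∀ i, T.seriesTerm i 0
      = T.ratio i * (Real.log (T.ratio i) + 2 * Real.eulerMascheroniConstant - 1)
                * tricomiPsi 2 2 (T.psiArg i)
            + T.ratio i * T.residualIntegral i 0 := fun i => by
    simp [TwoWayRelay.seriesTerm]
    ring
  refine ⟨fun i => ?_, fun i l => integrableOn_exp_mul_pow_mul_log_div (T.psiArg_pos i) l,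
    fun i => (summable_nat_add_iff 1).2 (hsum i).summable, ?_⟩
  · simp only [T.rate_eq]
    exact (T.integrable_log_one_add_snr hlaw hindep i).const_mul _
  · have e1 : (1 : Fin 2) - 0 = 1 := rfl
    have e2 : (1 : Fin 2) - 1 = 0 := rfl
    simp only [TwoWayRelay.ergodicCapacity, hrate, Fin.sum_univ_two, e1, e2, hzero]
    ring
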